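/- **Conventions.** All topological abelian groups considered have a base of neighbourhoods of zero consisting of open subgroups. Such a group $A$ is *separated* if it is Hausdorff, and *complete* if the map $A\to\varprojlim_U A/U$ ($U$ ranging over the open subgroups) is surjective. A family $(a_x)_{x\in X}$ in $A$ *converges to zero* if every neighbourhood of zero contains $a_x$ for all but finitely many $x\in X$. A closed subgroup $H\subset A$ of a complete separated $A$ is *strongly closed* if $A/H$ (with the quotient topology) is complete and, for every set $X$, every $X$-indexed family in $A/H$ converging to zero lifts to an $X$-indexed family in $A$ converging to zero. **Categories.** Let $\mathsf A$ be an additive category with set-indexed coproducts. It is *agreeable* if for all objects $M$ and all families $(N_x)_{x\in X}$ of objects the map $\operatorname{Hom}(M,\coprod_x N_x)\to\prod_x\operatorname{Hom}(M,N_x)$ given by composition with the projections is injective; a family $(f_x\colon M\to N_x)_{x\in X}$ is *summable* if it lies in the image of this map. A *right topological* structure on $\mathsf A$ consists of a group topology on each $\operatorname{Hom}(M,N)$ such that the composition maps $\operatorname{Hom}(L,M)\times\operatorname{Hom}(M,N)\to\operatorname{Hom}(L,N)$ are continuous and the open $\operatorname{End}(N)$-submodules form a base of neighbourhoods of zero in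 $\operatorname{Hom}(M,N)$. A *topologically agreeable* category is an agreeable category with a right topological structure for which all the groups $\operatorname{Hom}(M,N)$ are complete and separated and every summable family of morphisms $f_x\colon M\to N$ converges to zero in $\operatorname{Hom}(M,N)$. A family of nonzero objects $(M_z)_{z\in Z}$ of an agreeable category is *locally T-nilpotent* if for every sequence $z_1,z_2,\dots\in Z$ and all nonisomorphisms $f_i\colon M_{z_i}\to M_{z_{i+1}}$ the family $(f_n\cdots f_1\colon M_{z_1}\to M_{z_{n+1}})_{n\ge1}$ is summable. An object $M$ has a *perfect decomposition* if $M\cong\coprod_{z\in Z}M_z$ for some locally T-nilpotent family $(M_z)_{z\in Z}$. **Rings.** Let $R$ be a complete, separated topological ring in which the open right ideals form a base of neighbourhoods of zero. Its *topological Jacobson radical* $H(R)$ is the intersection of all open maximal right ideals; it is a two-sided ideal. The ring $R$ is *topologically left perfect* if 1. $H(R)$ is topologically left T-nilpotent: for all $a_1,a_2,\dots\in H(R)$ the sequence $a_1,\ a_1a_2,\ a_1a_2a_3,\dots$ converges to zero; 2. $H(R)$ is strongly closed in $R$; 3. the ring $R/H(R)$ with the quotient topology is topologically semisimple, i.e.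 isomorphic as a topological ring to a product $\prod_{x\in X}\operatorname{End}_{D_x}(D_x^{(Y_x)})^{\mathrm{op}}$, with the product topology, where the $D_x$ are division rings, the $Y_x$ are nonempty sets, and each endomorphism ring carries the finite topology (a base of neighbourhoods of zero is formed by the annihilators of finite subsets of $D_x^{(Y_x)}$). **Theorem.** Let $\mathsf A$ be an idempotent-complete topologically agreeable additive category, let $M$ be an object of $\mathsf A$, and let $R=\operatorname{Hom}_{\mathsf A}(M,M)^{\mathrm{op}}$ be the opposite endomorphism ring of $M$, where $\operatorname{Hom}_{\mathsf A}(M,M)$ acts on $M$ on the left, with its complete, separated, right linear topology. Then $M$ has a perfect decomposition if and only if the topological ring $R$ is topologically left perfect. -/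

import Mathlib

open CategoryTheory CategoryTheory.Limits Filter Topology

-- Makes `M ⟶ N` elaborate through the category structure itself.
attribute [-instance] CategoryTheory.catToReflQuiver

universe v u w

noncomputable section

namespace TopPerfect

/-! ### Topological abelian groups -/

/-- A topological abelian group is complete when the map `A → lim_U A / U`, where `U` ranges over
the open subgroups of `A`, is surjective. An element of the limit is given here by representatives
`a U` of its components in `A / U`. -/
def IsCompleteGroup (A : Type w) [AddCommGroup A] [TopologicalSpace A] : Prop :=
  ∀ a : OpenAddSubgroup A → A, (∀ U V : OpenAddSubgroup A, U ≤ V → a U - a V ∈ V) →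
    ∃ x : A, ∀ U : OpenAddSubgroup A, x - a U ∈ U

/-- A family of elements of a topological abelian group converges to zero when every neighbourhood
of zero contains all but finitely many of its members. -/
def ZeroConvergent {A : Type w} [AddCommGroup A] [TopologicalSpace A] {X : Type*}
    (a : X → A) : Prop :=
  Tendsto a cofinite (𝓝 0)

/-- A closed subgroup `H` of `A` is strongly closed when `A / H` is complete and every
zero-convergent family in `A / H` lifts to a zero-convergent family in `A`. -/
structure IsStronglyClosed {A : Type w} [AddCommGroup A] [TopologicalSpace A]
    (H : AddSubgroup A) : Prop where
  isClosed : IsClosed (H : Set A)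
  complete_quotient : IsCompleteGroup (A ⧸ H)
  exists_lift : ∀ (X : Type w) (s : X → A ⧸ H), ZeroConvergent s →
    ∃ a : X → A, ZeroConvergent a ∧ ∀ x, (QuotientAddGroup.mk (a x) : A ⧸ H) = s x

/-! ### Topological rings. Right ideals of `R` are the `Rᵐᵒᵖ`-submodules of `R`. -/

section Rings

variable (R : Type w) [Ring R] [TopologicalSpace R]

/-- A subset `E` is topologically left T-nilpotent when `a₁`, `a₁a₂`, `a₁a₂a₃`, … converges to
zero for every sequence of elements `a₁, a₂, a₃, …` of `E`. -/
def IsTopLeftTNilpotent {R : Type w} [Ring R] [TopologicalSpace R] (E : Set R) : Prop :=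
  ∀ a : ℕ → R, (∀ i, a i ∈ E) →
    Tendsto (fun n : ℕ => ((List.range (n + 1)).map a).prod) atTop (𝓝 0)

variable [IsTopologicalRing R]

variable {R} in
/-- An intersection of all open maximal right ideals is stable under left multiplication. -/
theorem mul_mem_openMaximal (r : R) {h : R}
    (hh : ∀ I : Submodule Rᵐᵒᵖ R, IsOpen (I : Set R) → IsCoatom I → h ∈ I)
    (I : Submodule Rᵐᵒᵖ R) (hI : IsOpen (I : Set R)) (hm : IsCoatom I) : r * h ∈ I := by
  let J : Submodule Rᵐᵒᵖ R :=
    { carrier := {s | r * s ∈ I}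
      add_mem' := fun {a b} ha hb => by
        simpa only [Set.mem_ofPred_eq, mul_add] using I.add_mem ha hb
      zero_mem' := by simp
      smul_mem' := fun c x hx => by
        have := I.smul_mem c hx
        simpa only [Set.mem_ofPred_eq, MulOpposite.smul_eq_mul_unop, mul_assoc] using this }
  have hmemJ : ∀ s, s ∈ J ↔ r * s ∈ I := fun s => Iff.rfl
  have hJo : IsOpen (J : Set R) := hI.preimage (continuous_const_mul r)
  by_cases hr : r ∈ I
  · have := I.smul_mem (MulOpposite.op h) hr
    simpa only [MulOpposite.smul_eq_mul_unop, MulOpposite.unop_op] using this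
  · refine (hmemJ h).1 (hh J hJo ⟨fun hJ => hr ?_, fun K hK => ?_⟩)
    · have : (1 : R) ∈ J := hJ ▸ Submodule.mem_top
      simpa using (hmemJ 1).1 this
    · obtain ⟨hle, k, hkK, hkJ⟩ := SetLike.lt_iff_le_and_exists.1 hK
      have htop : I ⊔ Submodule.span Rᵐᵒᵖ {r * k} = ⊤ := by
        refine hm.2 _ (lt_of_le_of_ne le_sup_left fun he => hkJ ((hmemJ k).2 ?_))
        rw [he]
        exact Submodule.mem_sup_right (Submodule.mem_span_singleton_self _)
      have hrm : r ∈ I ⊔ Submodule.span Rᵐᵒᵖ {r * k} := htop ▸ Submodule.mem_top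
      obtain ⟨i, hi, y, hy, hiy⟩ := Submodule.mem_sup.1 hrm
      obtain ⟨t, rfl⟩ := Submodule.mem_span_singleton.1 hy
      have h1 : (1 : R) - k * t.unop ∈ J := by
        rw [hmemJ]
        have : r * (1 - k * t.unop) = i := by
          rw [MulOpposite.smul_eq_mul_unop] at hiy
          rw [mul_sub, mul_one, ← mul_assoc, sub_eq_iff_eq_add, hiy]
        rwa [this]
      have h2 : k * t.unop ∈ K := by
        simpa only [MulOpposite.smul_eq_mul_unop] using K.smul_mem t hkK
      have h3 : (1 : R) ∈ K := by simpa using K.add_mem (hle h1) h2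
      refine (Submodule.eq_top_iff').2 fun x => ?_
      simpa [MulOpposite.smul_eq_mul_unop] using K.smul_mem (MulOpposite.op x) h3

/-- The topological Jacobson radical: the intersection of all open maximal right ideals. It is
a two-sided ideal. -/
def topJacobson : Ideal R where
  carrier := {r | ∀ I : Submodule Rᵐᵒᵖ R, IsOpen (I : Set R) → IsCoatom I → r ∈ I}
  add_mem' := fun ha hb I hI hm => I.add_mem (ha I hI hm) (hb I hI hm)
  zero_mem' := fun I _ _ => I.zero_mem
  smul_mem' := fun c _ hx => mul_mem_openMaximal c hx

instance : (topJacobson R).IsTwoSided where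
  mul_mem_of_left := fun b ha I hI hm => by
    simpa only [MulOpposite.smul_eq_mul_unop, MulOpposite.unop_op] using
      I.smul_mem (MulOpposite.op b) (ha I hI hm)

end Rings

/-- The finite topology on `End_A(M)`: the topology of pointwise convergence, with `M` discrete.
A base of neighbourhoods of zero is given by the annihilators of the finite subsets (equivalently,
of the finitely generated submodules) of `M`. -/
abbrev finiteTopology (A : Type*) (M : Type*) [Ring A] [AddCommGroup M] [Module A M] :
    TopologicalSpace (Module.End A M) :=
  TopologicalSpace.induced (fun f : Module.End A M => (f : M → M))
    (@Pi.topologicalSpace M (fun _ => M) (fun _ => ⊥))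

section Semisimple

attribute [local instance] finiteTopology

/-- A topological ring is topologically semisimple when it is isomorphic, as a topological ring,
to a product `∏ₓ End_{Dₓ}(Dₓ^(Yₓ))ᵒᵖ` (with the product topology) of the opposite endomorphism
rings of nonzero vector spaces over division rings, with their finite topologies. -/
def IsTopSemisimple (S : Type w) [Ring S] [TopologicalSpace S] : Prop :=
  ∃ (X : Type w) (Y : X → Type w) (D : X → Type w) (_ : ∀ x, DivisionRing (D x)),
    (∀ x, Nonempty (Y x)) ∧
      ∃ e : S ≃+* ((x : X) → (Module.End (D x) (Y x →₀ D x))ᵐᵒᵖ), IsHomeomorph e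

end Semisimple

/-- Topological left perfectness of a (complete, separated, right linear) topological ring. -/
structure IsTopLeftPerfect (R : Type w) [Ring R] [TopologicalSpace R] [IsTopologicalRing R] :
    Prop where
  tNilpotent : IsTopLeftTNilpotent (topJacobson R : Set R)
  stronglyClosed : IsStronglyClosed (topJacobson R).toAddSubgroup
  semisimple : IsTopSemisimple (R ⧸ topJacobson R)

/-! ### Agreeable and topologically agreeable categories -/

section Categories

variable (C : Type u) [Category.{v} C] [Preadditive C]

variable {C} in
/-- The projection `∐ N ⟶ N x`: the identity on the summand `N x` and zero on the others. -/
def coprodProj {X : Type v} (N : X → C) [HasCoproduct N] (x : X) : ∐ N ⟶ N x :=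
  letI := Classical.decEq X
  Sigma.π N x

/-- An additive category with coproducts is agreeable when a morphism into a coproduct is
determined by its compositions with the projections onto the summands. -/
class Agreeable [HasCoproducts.{v} C] : Prop where
  eta_injective : ∀ (M : C) (X : Type v) (N : X → C),
    Function.Injective (fun (f : M ⟶ ∐ N) (x : X) => f ≫ coprodProj N x)

variable {C} in
/-- A family of morphisms `M ⟶ N x` is summable when it consists of the components of
a morphism from `M` to the coproduct of the `N x`. -/
def IsSummable [HasCoproducts.{v} C] {M : C} {X : Type v} {N : X → C}
    (f : (x : X) → (M ⟶ N x)) : Prop :=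
  ∃ F : M ⟶ ∐ N, ∀ x, F ≫ coprodProj N x = f x

/-- A right topological additive category: the groups of morphisms are topological groups,
composition is continuous in the pair of arguments, and the open `End(N)`-submodules form a base of
neighbourhoods of zero in `Hom(M, N)`. -/
class RightTopological where
  homTopology : ∀ M N : C, TopologicalSpace (M ⟶ N)
  isTopologicalAddGroup : ∀ M N : C, IsTopologicalAddGroup (M ⟶ N)
  continuous_comp : ∀ L M N : C,
    Continuous (fun p : (L ⟶ M) × (M ⟶ N) => p.1 ≫ p.2)
  exists_open_submodule : ∀ (M N : C), ∀ U ∈ 𝓝 (0 : M ⟶ N),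
    ∃ V : AddSubgroup (M ⟶ N), IsOpen (V : Set (M ⟶ N)) ∧
      (∀ f ∈ V, ∀ g : N ⟶ N, f ≫ g ∈ V) ∧ (V : Set (M ⟶ N)) ⊆ U

attribute [reducible] RightTopological.homTopology

attribute [instance] RightTopological.homTopology RightTopological.isTopologicalAddGroup

/-- A topologically agreeable category: an agreeable category with a complete, separated right
topological structure in which all summable families converge to zero. -/
class TopologicallyAgreeable [HasCoproducts.{v} C] [RightTopological C] : Prop
    extends Agreeable C where
  complete : ∀ M N : C, IsCompleteGroup (M ⟶ N)
  separated : ∀ M N : C, T2Space (M ⟶ N)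
  zeroConvergent_of_summable : ∀ (M N : C) (X : Type v) (f : X → (M ⟶ N)),
    IsSummable f → ZeroConvergent f

section

variable {C} [RightTopological C]

instance (M : C) : TopologicalSpace (End M) :=
  RightTopological.homTopology M M

instance (M : C) : IsTopologicalRing (End M) where
  continuous_add := (RightTopological.isTopologicalAddGroup M M).continuous_add
  continuous_neg := (RightTopological.isTopologicalAddGroup M M).continuous_neg
  continuous_mul := (RightTopological.continuous_comp M M M).comp continuous_swap

end

/-! ### Perfect decompositions -/

variable {C}

/-- The composition `N₀ ⟶ N₁ ⟶ ⋯ ⟶ N₍ₙ₊₁₎` of the first `n + 1` morphisms of a sequence. -/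
def compSeq {N : ℕ → C} (f : (i : ℕ) → (N i ⟶ N (i + 1))) : (n : ℕ) → (N 0 ⟶ N (n + 1))
  | 0 => f 0
  | n + 1 => compSeq f n ≫ f (n + 1)

/-- Local T-nilpotency of a family of nonzero objects. -/
structure IsLocallyTNilpotent [HasCoproducts.{v} C] {Z : Type v} (N : Z → C) : Prop where
  nonzero : ∀ z, ¬ IsZero (N z)
  summable : ∀ (z : ℕ → Z) (f : (i : ℕ) → (N (z i) ⟶ N (z (i + 1)))), (∀ i, ¬ IsIso (f i)) →
    IsSummable (fun n : ULift.{v} ℕ => compSeq (N := fun i => N (z i)) f n.down)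

/-- An object has a perfect decomposition when it is the coproduct of a locally T-nilpotent family
of objects. -/
def HasPerfectDecomposition [HasCoproducts.{v} C] (M : C) : Prop :=
  ∃ (Z : Type v) (N : Z → C), IsLocallyTNilpotent N ∧ Nonempty (M ≅ ∐ N)

end Categories

end TopPerfect

end

/-!
Splitting idempotents turns the decompositions `M ≅ ∐ N z` into the families `e` of orthogonal
idempotents of `R = (End M)ᵐᵒᵖ` with `∑ e z = 1`. The morphisms `N z ⟶ N w` become the elements of
`e z * R * e w`, summable families of morphisms are the same as zero-convergent ones, and the
decomposition is perfect when all infinite products of nonisomorphisms between the idempotents tend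
to zero. So the question is when `R` has such a perfect family.

Given a perfect family, the rings `e z * R * e z` are local, and the elements all of whose entries
in the `e z * R * e w` are nonisomorphisms form the topological Jacobson radical `H`. It is
T-nilpotent by an argument as in Kőnig's lemma: if the products of a sequence stayed outside some
open right ideal, then so would the products along some sequence of entries. In `R ⧸ H` the right
ideals generated by the `e z` are simple. One of each isomorphism type is a vector space over its
endomorphism ring, and `R ⧸ H` is the product of the endomorphism rings of these vector spaces.

Conversely, matrix units give a family of idempotents in `R ⧸ H` for which all nonzero elements
between two corners are isomorphisms. Since zero-convergent families lift from `R ⧸ H` and `H` is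
T-nilpotent, this family lifts to orthogonal idempotents of `R` with sum one. The nonisomorphisms
between them lie in `H`, and T-nilpotency of `H` applies once more.
-/

noncomputable section

namespace TopPerfect

/-! ### Complete groups -/

section Groups

variable {A : Type w} [AddCommGroup A]

theorem IsCompleteGroup.completeSpace [UniformSpace A] [IsUniformAddGroup A]
    [NonarchimedeanAddGroup A] (hA : IsCompleteGroup A) : CompleteSpace A := by
  refine ⟨fun {f} hf => ?_⟩
  have := hf.1
  have small (U : OpenAddSubgroup A) : ∃ a, {y | y - a ∈ U} ∈ f := by
    have hU : {p : A × A | p.2 - p.1 ∈ U} ∈ uniformity A := by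
      rw [uniformity_eq_comap_nhds_zero]
      exact preimage_mem_comap U.mem_nhds_zero
    obtain ⟨s, hs, hsU⟩ := (cauchy_iff.1 hf).2 _ hU
    obtain ⟨a, ha⟩ := f.nonempty_of_mem hs
    exact ⟨a, mem_of_superset hs fun y hy => hsU (Set.mk_mem_prod ha hy)⟩
  choose a ha using small
  obtain ⟨x, hx⟩ := hA a fun U V hUV => by
    obtain ⟨y, hyU, hyV⟩ := f.nonempty_of_mem (inter_mem (ha U) (ha V))
    simpa using V.sub_mem hyV (hUV hyU)
  refine ⟨x, fun W hW => ?_⟩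
  have hW0 : (fun y => x + y) ⁻¹' W ∈ 𝓝 (0 : A) :=
    (continuous_const_add x).continuousAt.preimage_mem_nhds (by simpa using hW)
  obtain ⟨U, hU⟩ := NonarchimedeanAddGroup.is_nonarchimedean _ hW0
  refine mem_of_superset (ha U) fun y hy => ?_
  have hyx : y - x ∈ U := by simpa using U.sub_mem hy (hx U)
  simpa using hU hyx

variable [TopologicalSpace A]

theorem IsCompleteGroup.summable [NonarchimedeanAddGroup A] (hA : IsCompleteGroup A) {X : Type*}
    {a : X → A} (ha : ZeroConvergent a) : Summable a := by
  let := IsTopologicalAddGroup.rightUniformSpace A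
  have := isUniformAddGroup_of_addCommGroup (G := A)
  have := hA.completeSpace
  exact NonarchimedeanAddGroup.summable_of_tendsto_cofinite_zero ha

theorem IsCompleteGroup.exists_tendsto [NonarchimedeanAddGroup A] (hA : IsCompleteGroup A)
    {x : ℕ → A} (hx : Tendsto (fun n => x (n + 1) - x n) atTop (𝓝 0)) :
    ∃ l, Tendsto x atTop (𝓝 l) := by
  let := IsTopologicalAddGroup.rightUniformSpace A
  have := isUniformAddGroup_of_addCommGroup (G := A)
  have := hA.completeSpace
  exact cauchySeq_tendsto_of_complete (NonarchimedeanAddGroup.cauchySeq_of_tendsto_sub_nhds_zero hx)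

theorem mem_addSubgroup_of_hasSum {X : Type*} {f : X → A} {s : A} (h : HasSum f s)
    {U : AddSubgroup A} (hU : IsClosed (U : Set A)) (hf : ∀ x, f x ∈ U) : s ∈ U :=
  hU.mem_of_tendsto h (Eventually.of_forall fun _ => sum_mem fun x _ => hf x)

end Groups

/-! ### Right linear topological rings -/

section RightLinear

variable {R : Type w} [Ring R]

theorem mul_mem_rightIdeal (U : Submodule Rᵐᵒᵖ R) {a : R} (ha : a ∈ U) (b : R) : a * b ∈ U :=
  U.smul_mem (MulOpposite.op b) ha

variable [TopologicalSpace R]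

theorem ZeroConvergent.mul [IsLinearTopology Rᵐᵒᵖ R] {X : Type*} {f : X → R}
    (hf : ZeroConvergent f) (g : X → R) : ZeroConvergent fun x => f x * g x :=
  IsLinearTopology.tendsto_mul_zero_of_left f g hf

theorem ZeroConvergent.finite_notMem {X : Type*} {f : X → R} (hf : ZeroConvergent f)
    {U : Submodule Rᵐᵒᵖ R} (hU : IsOpen (U : Set R)) : {x | f x ∉ U}.Finite :=
  hf (hU.mem_nhds U.zero_mem)

theorem IsTopLeftTNilpotent.isTopologicallyNilpotent {E : Set R} (hE : IsTopLeftTNilpotent E)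
    {h : R} (hh : h ∈ E) : IsTopologicallyNilpotent h := by
  rw [IsTopologicallyNilpotent, ← tendsto_add_atTop_iff_nat 1]
  simpa using hE (fun _ => h) fun _ => hh

variable [IsTopologicalRing R]

theorem isClosed_of_isOpen_rightIdeal {U : Submodule Rᵐᵒᵖ R} (hU : IsOpen (U : Set R)) :
    IsClosed (U.toAddSubgroup : Set R) :=
  AddSubgroup.isClosed_of_isOpen U.toAddSubgroup hU

theorem ZeroConvergent.const_mul {X : Type*} {f : X → R} (hf : ZeroConvergent f) (q : R) :
    ZeroConvergent fun x => q * f x := by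
  simpa [ZeroConvergent] using Tendsto.const_mul q hf

variable [IsLinearTopology Rᵐᵒᵖ R]

theorem exists_open_rightIdeal {W : Set R} (hW : W ∈ 𝓝 (0 : R)) :
    ∃ U : Submodule Rᵐᵒᵖ R, IsOpen (U : Set R) ∧ (U : Set R) ⊆ W := by
  simpa [and_assoc] using (IsLinearTopology.hasBasis_open_submodule Rᵐᵒᵖ).mem_iff.1 hW

instance nonarchimedeanAddGroup_of_isLinearTopology : NonarchimedeanAddGroup R where
  is_nonarchimedean _ hW :=
    let ⟨U, hU, hUW⟩ := exists_open_rightIdeal hW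
    ⟨⟨U.toAddSubgroup, hU⟩, hUW⟩

theorem tendsto_zero_iff_forall_open_rightIdeal {X : Type*} {l : Filter X} {f : X → R} :
    Tendsto f l (𝓝 0) ↔
      ∀ U : Submodule Rᵐᵒᵖ R, IsOpen (U : Set R) → ∀ᶠ x in l, f x ∈ U :=
  (IsLinearTopology.hasBasis_open_submodule Rᵐᵒᵖ).tendsto_right_iff

theorem exists_open_rightIdeal_notMem [T2Space R] {a : R} (ha : a ≠ 0) :
    ∃ U : Submodule Rᵐᵒᵖ R, IsOpen (U : Set R) ∧ a ∉ U := by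
  obtain ⟨U, hU, hUa⟩ := exists_open_rightIdeal (isOpen_ne.mem_nhds ha.symm)
  exact ⟨U, hU, fun h => hUa h rfl⟩

theorem IsCompleteGroup.isUnit_one_sub [T2Space R] (hR : IsCompleteGroup R) {h : R}
    (hh : IsTopologicallyNilpotent h) : IsUnit (1 - h) := by
  have hs : Summable (h ^ ·) := hR.summable (by
    rwa [ZeroConvergent, Nat.cofinite_eq_atTop])
  exact ⟨⟨_, _, hs.one_sub_mul_tsum_pow, hs.tsum_pow_mul_one_sub⟩, rfl⟩

end RightLinear

theorem isLinearTopology_of_forall_exists_addSubgroup {R : Type*} [Ring R] [TopologicalSpace R]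
    [IsTopologicalRing R] (h : ∀ W ∈ 𝓝 (0 : R), ∃ V : AddSubgroup R, IsOpen (V : Set R) ∧
      (∀ a ∈ V, ∀ b, a * b ∈ V) ∧ (V : Set R) ⊆ W) : IsLinearTopology Rᵐᵒᵖ R := by
  refine isLinearTopology_iff_hasBasis_open_submodule.2 ⟨fun W => ⟨fun hW => ?_, ?_⟩⟩
  · obtain ⟨V, hVo, hV, hVW⟩ := h W hW
    exact ⟨{ V with smul_mem' := fun c a ha => hV a ha c.unop }, hVo, hVW⟩
  · rintro ⟨U, hU, hUW⟩
    exact mem_of_superset (hU.mem_nhds U.zero_mem) hUW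

/-! ### Lifting idempotents -/

/-- The step of Newton's method for the equation `y ^ 2 = y`, with the inverse of the derivative
`2 * y - 1` replaced by `2 * y - 1` itself, which is its inverse modulo `y ^ 2 - y`. -/
def idempotentNewton {A : Type*} [CommRing A] (y : A) : A :=
  3 * y ^ 2 - 2 * y ^ 3

section Newton

variable {A : Type*} [CommRing A]

theorem pow_dvd_iterate_idempotentNewton (y : A) (n : ℕ) :
    (y ^ 2 - y) ^ 2 ^ n ∣ (idempotentNewton^[n] y) ^ 2 - idempotentNewton^[n] y := by
  induction n with
  | zero => simp
  | succ n ih =>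
    rw [Function.iterate_succ_apply', pow_succ 2 n, pow_mul]
    refine (pow_dvd_pow_of_dvd ih 2).trans ⟨4 * ((idempotentNewton^[n] y) ^ 2
      - idempotentNewton^[n] y) - 3, ?_⟩
    simp only [idempotentNewton]
    ring

theorem pow_dvd_iterate_idempotentNewton_succ_sub (y : A) (n : ℕ) :
    (y ^ 2 - y) ^ 2 ^ n ∣ idempotentNewton^[n + 1] y - idempotentNewton^[n] y := by
  refine (pow_dvd_iterate_idempotentNewton y n).trans ⟨1 - 2 * idempotentNewton^[n] y, ?_⟩
  rw [Function.iterate_succ_apply', idempotentNewton]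
  ring

theorem dvd_iterate_idempotentNewton_sub (y : A) (n : ℕ) :
    y ^ 2 - y ∣ idempotentNewton^[n] y - y := by
  induction n with
  | zero => simp
  | succ n ih =>
    have := (dvd_pow_self (y ^ 2 - y) (Nat.two_pow_pos n).ne').trans
      (pow_dvd_iterate_idempotentNewton_succ_sub y n)
    simpa using this.add ih

end Newton

section IdempotentLift

variable {R : Type w} [Ring R] [TopologicalSpace R] [IsTopologicalRing R]
  [IsLinearTopology Rᵐᵒᵖ R] [T2Space R]

/-- Newton's method takes place in `ℤ[X]`, where everything commutes, and is then evaluated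
at `a`. -/
theorem IsCompleteGroup.exists_isIdempotentElem_sub_mem (hR : IsCompleteGroup R) {H : Ideal R}
    [H.IsTwoSided] (hH : IsClosed (H : Set R)) {a : R} (ha : a ^ 2 - a ∈ H)
    (hn : IsTopologicallyNilpotent (a ^ 2 - a)) :
    ∃ e, IsIdempotentElem e ∧ e - a ∈ H := by
  let φ := Polynomial.aeval (R := ℤ) a
  have hφ : φ (.X ^ 2 - .X) = a ^ 2 - a := by simp [φ]
  let x : ℕ → R := fun n => φ (idempotentNewton^[n] .X)
  have tendsto_of_dvd {p : ℕ → Polynomial ℤ} (hp : ∀ n, (.X ^ 2 - .X) ^ 2 ^ n ∣ p n) :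
      Tendsto (fun n => φ (p n)) atTop (𝓝 0) := by
    choose q hq using hp
    simp only [hq, map_mul, map_pow, hφ]
    exact IsLinearTopology.tendsto_mul_zero_of_left _ _
      (hn.comp (tendsto_pow_atTop_atTop_of_one_lt one_lt_two))
  obtain ⟨e, he⟩ : ∃ e, Tendsto x atTop (𝓝 e) := hR.exists_tendsto (by
    simpa only [x, ← map_sub] using tendsto_of_dvd (pow_dvd_iterate_idempotentNewton_succ_sub _))
  have hν : Tendsto (fun n => x n ^ 2 - x n) atTop (𝓝 0) := by
    simpa only [x, ← map_pow, ← map_sub] using tendsto_of_dvd (pow_dvd_iterate_idempotentNewton _)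
  have hxa (n : ℕ) : x n - a ∈ H := by
    obtain ⟨q, hq⟩ := dvd_iterate_idempotentNewton_sub (.X : Polynomial ℤ) n
    have hxn : x n - a = (a ^ 2 - a) * φ q := by
      rw [← hφ, ← map_mul, ← hq, map_sub, Polynomial.aeval_X]
    exact hxn ▸ H.mul_mem_right _ ha
  refine ⟨e, ?_, hH.mem_of_tendsto (he.sub_const a) (Eventually.of_forall hxa)⟩
  have := tendsto_nhds_unique ((he.pow 2).sub he) hν
  rwa [sub_eq_zero, pow_two] at this

end IdempotentLift

/-! ### Quotients by two-sided ideals -/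

section Quotient

variable {R : Type*} [Ring R] [TopologicalSpace R] [IsTopologicalRing R] (H : Ideal R)
  [H.IsTwoSided]

theorem isOpenQuotientMap_mk : IsOpenQuotientMap (Ideal.Quotient.mk H) :=
  H.isOpenQuotientMap_mkQ

instance : IsTopologicalRing (R ⧸ H) where
  __ := H.topologicalAddGroup_quotient
  continuous_mul := by
    rw [← ((isOpenQuotientMap_mk H).prodMap (isOpenQuotientMap_mk H)).continuous_comp_iff]
    exact (isOpenQuotientMap_mk H).continuous.comp continuous_mul

instance [IsLinearTopology Rᵐᵒᵖ R] : IsLinearTopology (R ⧸ H)ᵐᵒᵖ (R ⧸ H) := by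
  refine isLinearTopology_of_forall_exists_addSubgroup fun W hW => ?_
  have hW' : Ideal.Quotient.mk H ⁻¹' W ∈ 𝓝 0 :=
    (isOpenQuotientMap_mk H).continuous.continuousAt.preimage_mem_nhds (by rwa [map_zero])
  obtain ⟨U, hU, hUW⟩ := exists_open_rightIdeal hW'
  refine ⟨U.toAddSubgroup.map (Ideal.Quotient.mk H).toAddMonoidHom,
    (isOpenQuotientMap_mk H).isOpenMap _ hU, ?_, Set.image_subset_iff.2 hUW⟩
  rintro _ ⟨a, ha, rfl⟩ b
  obtain ⟨b, rfl⟩ := Ideal.Quotient.mk_surjective b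
  exact ⟨a * b, mul_mem_rightIdeal U ha b, map_mul (Ideal.Quotient.mk H) a b⟩

theorem hasSum_mk {X : Type*} {f : X → R} {s : R} (hf : HasSum f s) :
    HasSum (fun x => Ideal.Quotient.mk H (f x)) (Ideal.Quotient.mk H s) :=
  hf.map _ (isOpenQuotientMap_mk H).continuous

end Quotient

/-! ### Lifting families of orthogonal idempotents -/

/-- A family of pairwise orthogonal idempotents, possibly infinite, which sums to `1` in the
topology of the ring. -/
structure TopCompleteOrthogonalIdempotents {R : Type*} [Ring R] [TopologicalSpace R] {Z : Type*}
    (e : Z → R) : Prop extends OrthogonalIdempotents e where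
  hasSum_one : HasSum e 1

theorem exists_seq_of_forall_exists_mul {R α : Type*} [Monoid R] {P : R → α → Prop}
    {Q : α → R → α → Prop} (h : ∀ q x, P q x → ∃ a y, Q x a y ∧ P (q * a) y) {q : R} {x : α}
    (hq : P q x) :
    ∃ (a : ℕ → R) (y : ℕ → α), y 0 = x ∧ (∀ n, Q (y n) (a n) (y (n + 1))) ∧
      ∀ n, P (q * ((List.range n).map a).prod) (y n) := by
  choose a y hQ hP using h
  let s : ℕ → {p : R × α // P p.1 p.2} := fun n =>
    n.rec ⟨(q, x), hq⟩ fun _ p => ⟨(p.1.1 * a _ _ p.2, y _ _ p.2), hP _ _ p.2⟩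
  have hs (n : ℕ) : (s n).1.1 = q * ((List.range n).map fun n => a _ _ (s n).2).prod := by
    induction n with
    | zero => simp [s]
    | succ n ih =>
      rw [List.range_succ, List.map_append, List.prod_append, ← mul_assoc, ← ih]
      simp [s]
  exact ⟨fun n => a _ _ (s n).2, fun n => (s n).1.2, rfl, fun n => hQ _ _ (s n).2,
    fun n => hs n ▸ (s n).2⟩

section OrthogonalLift

variable {R : Type w} [Ring R] [TopologicalSpace R] [IsTopologicalRing R]
  [IsLinearTopology Rᵐᵒᵖ R] [T2Space R] {Z : Type*}

/-- If `k w z` is not in `U`, then neither is some `k w y₁ * k y₁ z`, nor some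
`k w y₁ * k y₁ y₂ * k y₂ z`, and so on. -/
theorem IsTopLeftTNilpotent.eq_zero_of_hasSum_mul {E : Set R} (hE : IsTopLeftTNilpotent E)
    {k : Z → Z → R} (hkE : ∀ w z, k w z ∈ E)
    (hk : ∀ w z, HasSum (fun y => k w y * k y z) (k w z)) (w z : Z) : k w z = 0 := by
  by_contra hwz
  obtain ⟨U, hU, hUk⟩ := exists_open_rightIdeal_notMem hwz
  have extend (q : R) (x : Z) (hq : q * k x z ∉ U) :
      ∃ a y, (a ∈ E) ∧ q * a * k y z ∉ U := by
    contrapose! hq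
    refine mem_addSubgroup_of_hasSum ((hk x z).mul_left q) (isClosed_of_isOpen_rightIdeal hU)
      fun y => ?_
    rw [← mul_assoc]
    exact hq _ y (hkE x y)
  obtain ⟨a, y, -, haE, ha⟩ := exists_seq_of_forall_exists_mul (P := fun q x => q * k x z ∉ U)
    (Q := fun _ a _ => a ∈ E) extend (q := 1) (x := w) (by rwa [one_mul])
  obtain ⟨n, hn⟩ := ((hE a haE).eventually (hU.mem_nhds U.zero_mem)).exists
  exact ha (n + 1) (by rw [one_mul]; exact mul_mem_rightIdeal U hn _)

/-- The matrix `k` with entries `k w z = δ w z * f w - f w * b z` is idempotent. -/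
theorem IsTopLeftTNilpotent.topCompleteOrthogonalIdempotents {H : AddSubgroup R}
    (hH : IsTopLeftTNilpotent (H : Set R)) {f b : Z → R} (hf : ∀ z, IsIdempotentElem (f z))
    (hbf : ∀ z, b z * f z = b z) (hb : HasSum b 1) (hdiag : ∀ z, f z - f z * b z ∈ H)
    (hoff : Pairwise fun w z => f w * b z ∈ H) : TopCompleteOrthogonalIdempotents b := by
  classical
  let k : Z → Z → R := fun w z => (if w = z then f w else 0) - f w * b z
  have hkH (w z : Z) : k w z ∈ H := by
    by_cases hwz : w = z
    · simpa [k, hwz] using hdiag z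
    · simpa [k, hwz] using hoff hwz
  have hfk (w z : Z) : f w * k w z = k w z := by
    simp only [k, mul_sub, mul_ite, mul_zero, ← mul_assoc, (hf w).eq]
  have hbk (w : Z) : HasSum (fun y => b y * k y w) 0 := by
    have := (hasSum_ite_eq w (b w)).sub (hb.mul_right (b w))
    rw [one_mul, sub_self] at this
    refine this.congr_fun fun y => ?_
    rw [mul_sub, ← mul_assoc, hbf]
    by_cases hyw : y = w <;> simp [hyw, hbf]
  have hkk (w z : Z) : HasSum (fun y => k w y * k y z) (k w z) := by
    have := (hasSum_ite_eq w (k w z)).sub ((hbk z).mul_left (f w))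
    rw [mul_zero, sub_zero] at this
    refine this.congr_fun fun y => ?_
    rw [sub_mul, mul_assoc]
    by_cases hwy : w = y
    · simp [← hwy, hfk]
    · simp [hwy, Ne.symm hwy]
  have hfb (w z : Z) : f w * b z = if w = z then f w else 0 :=
    (sub_eq_zero.1 (hH.eq_zero_of_hasSum_mul hkH hkk w z)).symm
  refine ⟨⟨fun z => ?_, fun w z hwz => ?_⟩, hb⟩
  · calc b z * b z = b z * (f z * b z) := by rw [← mul_assoc, hbf]
      _ = b z := by rw [hfb, if_pos rfl, hbf]
  · calc b w * b z = b w * (f w * b z) := by rw [← mul_assoc, hbf]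
      _ = 0 := by rw [hfb, if_neg hwz, mul_zero]

theorem IsCompleteGroup.exists_topCompleteOrthogonalIdempotents_lift (hR : IsCompleteGroup R)
    {H : Ideal R} [H.IsTwoSided] (hH : IsClosed (H : Set R))
    (hn : IsTopLeftTNilpotent (H : Set R)) {a : Z → R} (ha : ZeroConvergent a)
    (hs : TopCompleteOrthogonalIdempotents fun z => Ideal.Quotient.mk H (a z)) :
    ∃ e : Z → R, TopCompleteOrthogonalIdempotents e ∧
      ∀ z, Ideal.Quotient.mk H (e z) = Ideal.Quotient.mk H (a z) := by
  let π := Ideal.Quotient.mk H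
  have mem_iff (r : R) : r ∈ H ↔ π r = 0 := Ideal.Quotient.eq_zero_iff_mem.symm
  have haa (z : Z) : a z ^ 2 - a z ∈ H := by
    rw [mem_iff, map_sub, map_pow, pow_two, (hs.idem z).eq, sub_self]
  choose f hf hfa using fun z => hR.exists_isIdempotentElem_sub_mem hH (haa z)
    (hn.isTopologicallyNilpotent (haa z))
  have hπf (z : Z) : π (f z) = π (a z) := Ideal.Quotient.eq.2 (hfa z)
  obtain ⟨s, haf⟩ := hR.summable (ha.mul f)
  have hπs : π s = 1 := by
    refine ((hasSum_mk H haf).congr_fun fun z => ?_).unique hs.hasSum_one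
    simp [hπf, (hs.idem z).eq, π]
  obtain ⟨u, rfl⟩ : IsUnit s := by
    have hs1 : 1 - s ∈ H := by rw [mem_iff, map_sub, hπs, map_one, sub_self]
    simpa using hR.isUnit_one_sub (hn.isTopologicallyNilpotent hs1)
  have hπu : π ↑u⁻¹ = 1 := by
    rw [← mul_one (π _), ← hπs, ← map_mul, Units.inv_mul, map_one, hπs]
  have hπb (z : Z) : π (↑u⁻¹ * (a z * f z)) = π (a z) := by
    rw [map_mul, hπu, one_mul, map_mul, hπf, (hs.idem z).eq]
  refine ⟨fun z => ↑u⁻¹ * (a z * f z), ?_, hπb⟩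
  refine hn.topCompleteOrthogonalIdempotents (H := H.toAddSubgroup) hf (fun z => ?_)
    (by simpa using haf.mul_left (↑u⁻¹ : R)) (fun z => ?_) fun w z hwz => ?_
  · rw [mul_assoc, mul_assoc, (hf z).eq]
  · refine (mem_iff _).2 ?_
    rw [map_sub, map_mul, hπb, hπf, (hs.idem z).eq, sub_self]
  · refine (mem_iff _).2 ?_
    rw [map_mul, hπb, hπf]
    exact hs.ortho hwz

end OrthogonalLift

/-! ### Corners and local idempotents -/

section Corners

variable {R : Type*} [Ring R] {e f g a b : R}

/-- For idempotents `e` and `f`, the elements `a` of `e * R * f` and `b` of `f * R * e` are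
inverse to each other: they describe mutually inverse isomorphisms between the right modules
`f * R` and `e * R`. -/
structure IsCornerInverse (e f a b : R) : Prop where
  left_mul : e * a = a
  right_mul : f * b = b
  mul_eq_left : a * b = e
  mul_eq_right : b * a = f

namespace IsCornerInverse

theorem symm (h : IsCornerInverse e f a b) : IsCornerInverse f e b a :=
  ⟨h.right_mul, h.left_mul, h.mul_eq_right, h.mul_eq_left⟩

theorem mul_right (h : IsCornerInverse e f a b) : a * f = a := by
  rw [← h.mul_eq_right, ← mul_assoc, h.mul_eq_left, h.left_mul]

theorem trans {a' b' : R} (h : IsCornerInverse e f a b) (h' : IsCornerInverse f g a' b') :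
    IsCornerInverse e g (a * a') (b' * b) where
  left_mul := by rw [← mul_assoc, h.left_mul]
  right_mul := by rw [← mul_assoc, h'.right_mul]
  mul_eq_left := by
    rw [mul_assoc, ← mul_assoc a' b' b, h'.mul_eq_left, h.right_mul, h.mul_eq_left]
  mul_eq_right := by
    rw [mul_assoc, ← mul_assoc b a a', h.mul_eq_right, h'.left_mul, h'.mul_eq_right]

theorem refl (he : IsIdempotentElem e) : IsCornerInverse e e e e :=
  ⟨he, he, he, he⟩

theorem map {S F : Type*} [Ring S] [FunLike F R S] [MulHomClass F R S]
    (h : IsCornerInverse e f a b) (φ : F) : IsCornerInverse (φ e) (φ f) (φ a) (φ b) :=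
  ⟨by rw [← map_mul, h.left_mul], by rw [← map_mul, h.right_mul],
    by rw [← map_mul, h.mul_eq_left], by rw [← map_mul, h.mul_eq_right]⟩

end IsCornerInverse

/-- For idempotents `e` and `f`, the element `a` is an isomorphism between the corners of `e`
and `f`. -/
def IsCornerIso (e f a : R) : Prop :=
  ∃ b, IsCornerInverse e f a b

theorem IsCornerIso.of_left_right {c : R} (hea : e * a = a) (haf : a * f = a) (hab : a * b = e)
    (hca : c * a = f) : IsCornerIso e f a := by
  have hff : f * f = f := by
    nth_rw 1 [← hca]
    rw [mul_assoc, haf, hca]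
  refine ⟨f * b, hea, by rw [← mul_assoc, hff], by rw [← mul_assoc, haf, hab], ?_⟩
  rw [← hca, mul_assoc c a b, hab, mul_assoc, hea]

theorem IsCornerIso.of_quotient {H : Ideal R} [H.IsTwoSided] (hH : ∀ h ∈ H, IsUnit (1 - h))
    (he : IsIdempotentElem e) (hf : IsIdempotentElem f) (hea : e * a = a) (haf : a * f = a)
    (h : IsCornerIso (Ideal.Quotient.mk H e) (Ideal.Quotient.mk H f) (Ideal.Quotient.mk H a)) :
    IsCornerIso e f a := by
  obtain ⟨b', hb'⟩ := h
  obtain ⟨b, rfl⟩ := Ideal.Quotient.mk_surjective b'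
  obtain ⟨u, hu⟩ : IsUnit (1 - (e - a * b * e)) := hH _ <| Ideal.Quotient.eq.1 <| by
    rw [map_mul, map_mul, hb'.mul_eq_left, ← map_mul, he.eq]
  obtain ⟨v, hv⟩ : IsUnit (1 - (f - f * b * a)) := hH _ <| Ideal.Quotient.eq.1 <| by
    rw [map_mul, map_mul, hb'.right_mul, hb'.mul_eq_right]
  have hau : e * u = a * (b * e) := by
    rw [hu, mul_sub, mul_sub, mul_one, he.eq, ← mul_assoc, ← mul_assoc, hea]
    simp [mul_assoc]
  have hva : v * f = f * b * a := by
    rw [hv, sub_mul, sub_mul, one_mul, hf.eq, mul_assoc (f * b), haf]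
    simp
  refine .of_left_right (b := b * e * ↑u⁻¹) (c := ↑v⁻¹ * (f * b)) hea haf ?_ ?_
  · rw [← mul_assoc, ← hau, Units.mul_inv_cancel_right]
  · rw [mul_assoc, ← hva, Units.inv_mul_cancel_left]

/-- A nonzero idempotent `e` whose corner ring `e * R * e` is local. -/
structure IsLocalIdempotent (e : R) : Prop where
  idem : IsIdempotentElem e
  ne_zero : e ≠ 0
  exists_mul_eq_or : ∀ a, (∃ b, e * a * e * b = e) ∨ ∃ b, (e - e * a * e) * b = e

theorem IsLocalIdempotent.eq_zero_or_eq (he : IsLocalIdempotent e) {p : R}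
    (hp : IsIdempotentElem p) (hep : e * p = p) (hpe : p * e = p) : p = 0 ∨ p = e := by
  have key := he.exists_mul_eq_or p
  rw [hep, hpe] at key
  obtain ⟨b, hb⟩ | ⟨b, hb⟩ := key
  · right
    rw [← hpe]
    nth_rw 1 [← hb]
    rw [← mul_assoc, hp.eq, hb]
  · left
    rw [← hpe, ← hb, ← mul_assoc, mul_sub, hpe, hp.eq, sub_self, zero_mul]

theorem IsLocalIdempotent.isCornerInverse (hf : IsLocalIdempotent f) (he : e ≠ 0)
    (hea : e * a = a) (haf : a * f = a) (hfb : f * b = b) (hab : a * b = e) :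
    IsCornerInverse e f a b := by
  have hba : IsIdempotentElem (b * a) := by
    rw [IsIdempotentElem, mul_assoc, ← mul_assoc a b a, hab, hea]
  refine ⟨hea, hfb, hab, (hf.eq_zero_or_eq hba ?_ ?_).resolve_left fun h0 => he ?_⟩
  · rw [← mul_assoc, hfb]
  · rw [mul_assoc, haf]
  · rw [← hab, ← hea, ← hab, mul_assoc, mul_assoc, ← mul_assoc b a b, h0, zero_mul, mul_zero]

/-- For a local idempotent `e`, the elements `r` for which the left multiplication by `e * r` does
not map `R` onto `e * R`. They form the preimage, under `r ↦ e * r`, of the largest proper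
submodule of the right module `e * R`. -/
def IsLocalIdempotent.maximalRightIdeal (he : IsLocalIdempotent e) : Submodule Rᵐᵒᵖ R where
  carrier := {r | ∀ s, e * r * s ≠ e}
  zero_mem' s := by simpa using he.ne_zero.symm
  smul_mem' c r hr s := by
    simpa only [MulOpposite.smul_eq_mul_unop, mul_assoc] using hr (c.unop * s)
  add_mem' {r r'} hr hr' s hs := by
    obtain ⟨b, hb⟩ | ⟨b, hb⟩ := he.exists_mul_eq_or (r * s)
    · exact hr (s * e * b) (by simpa only [mul_assoc] using hb)
    · refine hr' (s * e * b) ?_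
      have : e - e * (r * s) * e = e * r' * s * e := by
        nth_rw 1 [← he.idem.eq, ← hs]
        noncomm_ring
      rw [this] at hb
      simpa only [mul_assoc] using hb

theorem IsLocalIdempotent.mem_maximalRightIdeal (he : IsLocalIdempotent e) {r : R} :
    r ∈ he.maximalRightIdeal ↔ ∀ s, e * r * s ≠ e :=
  Iff.rfl

theorem IsLocalIdempotent.isCoatom_maximalRightIdeal (he : IsLocalIdempotent e) :
    IsCoatom he.maximalRightIdeal := by
  refine ⟨fun htop => ?_, fun I hI => ?_⟩
  · have h1 : (1 : R) ∈ he.maximalRightIdeal := htop ▸ Submodule.mem_top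
    exact h1 e (by rw [mul_one, he.idem.eq])
  · obtain ⟨hle, r, hrI, hr⟩ := SetLike.lt_iff_le_and_exists.1 hI
    obtain ⟨s, hs⟩ : ∃ s, e * r * s = e := by simpa [he.mem_maximalRightIdeal] using hr
    have h1 : 1 - r * s ∈ I := hle fun t ht => he.ne_zero <| by
      rw [← ht, mul_sub, mul_one, ← mul_assoc, hs, sub_self, zero_mul]
    refine (Submodule.eq_top_iff').2 fun x => ?_
    simpa using mul_mem_rightIdeal I (I.add_mem h1 (mul_mem_rightIdeal I hrI s)) x

end Corners

/-! ### The topological Jacobson radical -/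

section TopJacobson

variable {R : Type*} [Ring R] [TopologicalSpace R] [IsTopologicalRing R]

theorem isClosed_topJacobson : IsClosed (topJacobson R : Set R) := by
  have : (topJacobson R : Set R) =
      ⋂ (I : Submodule Rᵐᵒᵖ R) (_ : IsOpen (I : Set R)) (_ : IsCoatom I), (I : Set R) := by
    ext r
    simp only [Set.mem_iInter]
    rfl
  rw [this]
  exact isClosed_iInter fun I => isClosed_iInter fun hI => isClosed_iInter fun _ =>
    isClosed_of_isOpen_rightIdeal hI

theorem mem_topJacobson_of_forall_isUnit {r : R} (hr : ∀ t, IsUnit (1 - r * t)) :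
    r ∈ topJacobson R := by
  intro I _ hI
  by_contra hrI
  have htop : I ⊔ Submodule.span Rᵐᵒᵖ {r} = ⊤ := hI.2 _ (left_lt_sup.2 fun h =>
    hrI (h (Submodule.mem_span_singleton_self r)))
  obtain ⟨i, hi, y, hy, hiy⟩ := Submodule.mem_sup.1 (htop ▸ Submodule.mem_top : (1 : R) ∈ _)
  obtain ⟨t, rfl⟩ := Submodule.mem_span_singleton.1 hy
  obtain ⟨u, hu⟩ := hr t.unop
  rw [← MulOpposite.smul_eq_mul_unop, ← hiy, add_sub_cancel_right] at hu
  refine hI.1 ((Submodule.eq_top_iff').2 fun x => ?_)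
  simpa [← hu] using mul_mem_rightIdeal I hi (↑u⁻¹ * x)

theorem IsLocalIdempotent.isOpen_maximalRightIdeal [IsLinearTopology Rᵐᵒᵖ R] [T2Space R] {e : R}
    (he : IsLocalIdempotent e) : IsOpen (he.maximalRightIdeal : Set R) := by
  obtain ⟨U, hU, heU⟩ := exists_open_rightIdeal_notMem he.ne_zero
  have hopen : IsOpen ((e * ·) ⁻¹' (U : Set R)) := hU.preimage (continuous_const_mul e)
  refine AddSubgroup.isOpen_of_mem_nhds he.maximalRightIdeal.toAddSubgroup (g := 0) <|
    mem_of_superset (hopen.mem_nhds (by simp)) fun r hr s hs => heU ?_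
  exact hs ▸ mul_mem_rightIdeal U hr s

theorem IsLocalIdempotent.topJacobson_le [IsLinearTopology Rᵐᵒᵖ R] [T2Space R] {e : R}
    (he : IsLocalIdempotent e) {r : R} (hr : r ∈ topJacobson R) : r ∈ he.maximalRightIdeal :=
  hr _ he.isOpen_maximalRightIdeal he.isCoatom_maximalRightIdeal

end TopJacobson

/-! ### Topologically complete families of orthogonal idempotents -/

section Families

variable {R : Type w} [Ring R] [TopologicalSpace R] {Z : Type*} {e : Z → R}

namespace TopCompleteOrthogonalIdempotents

theorem map {S : Type*} [Ring S] [TopologicalSpace S] (he : TopCompleteOrthogonalIdempotents e)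
    (φ : R →+* S) (hφ : Continuous φ) : TopCompleteOrthogonalIdempotents (φ ∘ e) where
  toOrthogonalIdempotents := he.toOrthogonalIdempotents.map φ
  hasSum_one := by simpa using he.hasSum_one.map φ hφ

variable [IsTopologicalRing R]

theorem hasSum_mul (he : TopCompleteOrthogonalIdempotents e) (x : R) :
    HasSum (fun z => e z * x) x := by
  simpa using he.hasSum_one.mul_right x

theorem zeroConvergent (he : TopCompleteOrthogonalIdempotents e) : ZeroConvergent e :=
  he.hasSum_one.summable.tendsto_cofinite_zero

theorem mem_of_forall_mul_mem (he : TopCompleteOrthogonalIdempotents e) {P : AddSubgroup R}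
    (hP : IsClosed (P : Set R)) {x : R} (hx : ∀ z, e z * x ∈ P) : x ∈ P :=
  mem_addSubgroup_of_hasSum (he.hasSum_mul x) hP hx

theorem eq_of_forall_mul_eq [T2Space R] (he : TopCompleteOrthogonalIdempotents e) {x y : R}
    (hxy : ∀ z, e z * x = e z * y) : x = y :=
  (he.hasSum_mul x).unique (by simpa only [hxy] using he.hasSum_mul y)

variable [IsLinearTopology Rᵐᵒᵖ R]

theorem exists_mul_eq [T2Space R] (he : TopCompleteOrthogonalIdempotents e)
    (hR : IsCompleteGroup R) (r : Z → R) : ∃ x, ∀ z, e z * x = e z * r z := by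
  classical
  obtain ⟨x, hx⟩ := hR.summable (he.zeroConvergent.mul r)
  refine ⟨x, fun z => (hx.mul_left (e z)).unique ?_⟩
  refine (hasSum_ite_eq z (e z * r z)).congr_fun fun w => ?_
  rw [← mul_assoc, he.mul_eq, ite_mul, zero_mul]
  by_cases hwz : w = z
  · simp [hwz]
  · simp [hwz, Ne.symm hwz]

theorem exists_finite_forall_mem (he : TopCompleteOrthogonalIdempotents e) {H P : AddSubgroup R}
    (hP : IsOpen (P : Set R)) (hHP : H ≤ P) :
    ∃ F : Finset Z, ∀ r, (∀ z ∈ F, e z * r ∈ H) → r ∈ P := by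
  obtain ⟨U, hU, hUP⟩ := exists_open_rightIdeal (hP.mem_nhds P.zero_mem)
  have hF := he.zeroConvergent.finite_notMem hU
  refine ⟨hF.toFinset, fun r hr => he.mem_of_forall_mul_mem (P.isClosed_of_isOpen hP) fun z => ?_⟩
  by_cases hz : e z ∈ U
  · exact hUP (mul_mem_rightIdeal U hz r)
  · exact hHP (hr z (by simpa using hz))

theorem isCompleteGroup_quotient [T2Space R] (he : TopCompleteOrthogonalIdempotents e)
    (hR : IsCompleteGroup R) {H : Ideal R} (hH : ∀ z, IsOpen {r | e z * r ∈ H}) :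
    IsCompleteGroup (R ⧸ H.toAddSubgroup) := by
  intro a ha
  let π : R →+ R ⧸ H.toAddSubgroup := QuotientAddGroup.mk' _
  have hπ (r : R) : π r = 0 ↔ r ∈ H := QuotientAddGroup.eq_zero_iff r
  let O (z : Z) : OpenAddSubgroup (R ⧸ H.toAddSubgroup) :=
    ⟨(H.toAddSubgroup.comap (AddMonoidHom.mulLeft (e z))).map π,
      QuotientAddGroup.isOpenMap_coe _ (hH z)⟩
  have mem_O (z : Z) (r : R) : π r ∈ O z ↔ e z * r ∈ H := by
    refine ⟨?_, fun hr => ⟨r, hr, rfl⟩⟩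
    rintro ⟨r', hr' : e z * r' ∈ H, hrr' : π r' = π r⟩
    have : r - r' ∈ H := by rw [← hπ, map_sub, hrr', sub_self]
    simpa [mul_sub] using H.add_mem (H.mul_mem_left (e z) this) hr'
  choose r hr using fun z => QuotientAddGroup.mk'_surjective H.toAddSubgroup (a (O z))
  obtain ⟨x, hx⟩ := he.exists_mul_eq hR r
  refine ⟨π x, fun U => ?_⟩
  obtain ⟨F, hF⟩ := he.exists_finite_forall_mem (H := H.toAddSubgroup)
    (P := U.toAddSubgroup.comap π) (U.isOpen.preimage continuous_quot_mk)
    fun h hh => by rw [AddSubgroup.mem_comap, (hπ h).2 hh]; exact U.zero_mem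
  obtain ⟨t, ht⟩ := QuotientAddGroup.mk'_surjective H.toAddSubgroup (a (U ⊓ F.inf O))
  have hxt : π (x - t) ∈ U := hF _ fun z hz => by
    have htr : π (t - r z) ∈ O z := by
      rw [map_sub, ht, hr]
      exact ha _ _ (inf_le_right.trans (Finset.inf_le hz))
    rw [mul_sub, hx, ← mul_sub, ← neg_sub, mul_neg]
    exact H.neg_mem ((mem_O z _).1 htr)
  have htU : π t - a U ∈ U := ht ▸ ha _ _ inf_le_left
  simpa using U.add_mem hxt htU

theorem exists_zeroConvergent_lift [T2Space R] (he : TopCompleteOrthogonalIdempotents e)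
    (hR : IsCompleteGroup R) {H : Ideal R} (hHc : IsClosed (H : Set R))
    (hH : ∀ z, IsOpen {r | e z * r ∈ H}) {X : Type*} {s : X → R ⧸ H.toAddSubgroup}
    (hs : ZeroConvergent s) :
    ∃ a : X → R, ZeroConvergent a ∧
      ∀ x, (QuotientAddGroup.mk (a x) : R ⧸ H.toAddSubgroup) = s x := by
  classical
  choose r hr using fun x => QuotientAddGroup.mk_surjective (s x)
  choose a ha using fun x => he.exists_mul_eq hR fun z => if e z * r x ∈ H then 0 else r x
  refine ⟨a, tendsto_zero_iff_forall_open_rightIdeal.2 fun U hU => ?_, fun x => ?_⟩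
  · obtain ⟨F, hF⟩ := he.exists_finite_forall_mem (H := ⊥) (P := U.toAddSubgroup) hU bot_le
    have hrow (z : Z) : ∀ᶠ x in cofinite, e z * r x ∈ H := by
      have := hs.eventually ((QuotientAddGroup.isOpenMap_coe _ (hH z)).mem_nhds
        ⟨0, by simp, rfl⟩)
      filter_upwards [this] with x ⟨r', hr', hx⟩
      rw [← hr, QuotientAddGroup.eq] at hx
      simpa [mul_add] using H.add_mem hr' (H.mul_mem_left (e z) hx)
    filter_upwards [(F.eventually_all).2 fun z _ => hrow z] with x hx
    refine hF _ fun z hz => ?_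
    rw [ha, if_pos (hx z hz), mul_zero]
    exact zero_mem _
  · rw [← hr x, eq_comm, QuotientAddGroup.eq]
    refine he.mem_of_forall_mul_mem hHc fun z => ?_
    rw [mul_add, ha]
    split_ifs with hz
    · simpa using hz
    · simp

theorem isStronglyClosed [T2Space R] (he : TopCompleteOrthogonalIdempotents e)
    (hR : IsCompleteGroup R) {H : Ideal R} (hHc : IsClosed (H : Set R))
    (hH : ∀ z, IsOpen {r | e z * r ∈ H}) : IsStronglyClosed H.toAddSubgroup :=
  ⟨hHc, he.isCompleteGroup_quotient hR hH, fun _ _ => he.exists_zeroConvergent_lift hR hHc hH⟩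

end TopCompleteOrthogonalIdempotents

end Families

/-! ### Perfect and semisimple families of idempotents -/

/-- A topologically complete family of nonzero orthogonal idempotents such that all nonzero
elements between their corners are isomorphisms. In the opposite endomorphism ring of an object,
this is a decomposition into objects which behave like simple ones. -/
structure IsSemisimpleFamily {R : Type*} [Ring R] [TopologicalSpace R] {Z : Type*} (e : Z → R) :
    Prop extends TopCompleteOrthogonalIdempotents e where
  ne_zero : ∀ z, e z ≠ 0
  isCornerIso : ∀ z w a, e z * a = a → a * e w = a → a ≠ 0 → IsCornerIso (e z) (e w) a

/-- A topologically complete family of nonzero orthogonal idempotents which is locally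
T-nilpotent: compositions of nonisomorphisms between their corners tend to zero. In the opposite
endomorphism ring of an object, this is a perfect decomposition. -/
structure IsPerfectFamily {R : Type*} [Ring R] [TopologicalSpace R] {Z : Type*} (e : Z → R) :
    Prop extends TopCompleteOrthogonalIdempotents e where
  ne_zero : ∀ z, e z ≠ 0
  tendsto_prod : ∀ (z : ℕ → Z) (a : ℕ → R), (∀ i, e (z i) * a i = a i) →
    (∀ i, a i * e (z (i + 1)) = a i) → (∀ i, ¬ IsCornerIso (e (z i)) (e (z (i + 1))) (a i)) →
      Tendsto (fun n => ((List.range (n + 1)).map a).prod) atTop (𝓝 0)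

section PerfectFamilies

variable {R : Type w} [Ring R] [TopologicalSpace R] [IsTopologicalRing R] {Z : Type*} {e : Z → R}

theorem TopCompleteOrthogonalIdempotents.exists_forall_mul_notMem
    (he : TopCompleteOrthogonalIdempotents e) {U : Submodule Rᵐᵒᵖ R} (hU : IsOpen (U : Set R))
    {c : ℕ → R} (hc : ∀ ⦃m n⦄, m ≤ n → c m ∣ c n) {p : R} (hp : ∀ m, p * c m ∉ U) :
    ∃ z, ∀ m, p * e z * c m ∉ U := by
  contrapose! hp
  have eventually_mem (z : Z) : ∀ᶠ m in atTop, p * e z * c m ∈ U := by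
    obtain ⟨m, hm⟩ := hp z
    filter_upwards [eventually_ge_atTop m] with n hmn
    obtain ⟨t, ht⟩ := hc hmn
    rw [ht, ← mul_assoc]
    exact mul_mem_rightIdeal U hm t
  have hfin : {z | p * e z ∉ U}.Finite := (he.zeroConvergent.const_mul p).finite_notMem hU
  obtain ⟨m, hm⟩ := (hfin.eventually_all.2 fun z _ => eventually_mem z).exists
  have hsum : HasSum (fun z => p * e z * c m) (p * c m) := by
    simpa only [mul_assoc] using (he.hasSum_mul (c m)).mul_left p
  refine ⟨m, mem_addSubgroup_of_hasSum hsum (isClosed_of_isOpen_rightIdeal hU) fun z => ?_⟩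
  by_cases hz : p * e z ∈ U
  · exact mul_mem_rightIdeal U hz (c m)
  · exact hm z hz

variable [IsLinearTopology Rᵐᵒᵖ R]

namespace IsPerfectFamily

theorem isTopLeftTNilpotent (he : IsPerfectFamily e) :
    IsTopLeftTNilpotent {r | ∀ z s, e z * r * s ≠ e z} := by
  intro a ha
  refine tendsto_zero_iff_forall_open_rightIdeal.2 fun U hU => ?_
  let c (n m : ℕ) : R := ((List.range' n m).map a).prod
  have c_dvd (n : ℕ) ⦃m m' : ℕ⦄ (h : m ≤ m') : c n m ∣ c n m' := by
    obtain ⟨k, rfl⟩ := Nat.exists_eq_add_of_le h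
    exact ⟨c (n + m) k, by simp [c, ← List.range'_append_1]⟩
  by_contra hfreq
  have hc (m : ℕ) : c 0 m ∉ U := fun hm => hfreq <| by
    filter_upwards [eventually_ge_atTop m] with n hn
    obtain ⟨t, ht⟩ := c_dvd 0 (hn.trans n.le_succ)
    rw [List.range_eq_range']
    exact (ht ▸ mul_mem_rightIdeal U hm t : c 0 (n + 1) ∈ U)
  have extend (q : R) (x : ℕ × Z) (hq : ∀ m, q * e x.2 * c x.1 m ∉ U) :
      ∃ (b : R) (y : ℕ × Z), (e x.2 * b = b ∧ b * e y.2 = b ∧ ¬ IsCornerIso (e x.2) (e y.2) b) ∧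
        ∀ m, q * b * e y.2 * c y.1 m ∉ U := by
    obtain ⟨w, hw⟩ := he.exists_forall_mul_notMem hU (c_dvd (x.1 + 1)) (p := q * e x.2 * a x.1)
      fun m => by simpa [c, List.range'_succ, mul_assoc] using hq (m + 1)
    refine ⟨e x.2 * a x.1 * e w, (x.1 + 1, w), ⟨?_, ?_, fun ⟨b, hb⟩ => ?_⟩, fun m => ?_⟩
    · simp only [← mul_assoc, (he.idem _).eq]
    · rw [mul_assoc, (he.idem _).eq]
    · exact ha x.1 x.2 (e w * b) (by rw [← mul_assoc, hb.mul_eq_left])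
    · simpa only [mul_assoc, (he.idem w).mul_self_mul] using hw m
  obtain ⟨w, hw⟩ := he.exists_forall_mul_notMem hU (c_dvd 0) (p := 1) (by simpa using hc)
  obtain ⟨b, y, -, hb, hbU⟩ := exists_seq_of_forall_exists_mul extend (x := (0, w)) hw
  have htend := he.tendsto_prod (fun n => (y n).2) b (fun n => (hb n).1) (fun n => (hb n).2.1)
    fun n => (hb n).2.2
  obtain ⟨n, hn⟩ := (htend.eventually (hU.mem_nhds U.zero_mem)).exists
  refine hbU (n + 1) 0 ?_
  rw [one_mul, mul_assoc]
  exact mul_mem_rightIdeal U hn _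

variable [T2Space R]

theorem isLocalIdempotent (he : IsPerfectFamily e) (hR : IsCompleteGroup R) (z : Z) :
    IsLocalIdempotent (e z) where
  idem := he.idem z
  ne_zero := he.ne_zero z
  exists_mul_eq_or a := by
    have hleft : e z * (e z * a * e z) = e z * a * e z := by
      simp only [← mul_assoc, (he.idem z).eq]
    have hright : e z * a * e z * e z = e z * a * e z := by rw [mul_assoc, (he.idem z).eq]
    by_cases hiso : IsCornerIso (e z) (e z) (e z * a * e z)
    · obtain ⟨b, hb⟩ := hiso
      exact .inl ⟨b, hb.mul_eq_left⟩
    · have hnil : IsTopLeftTNilpotent {e z * a * e z} := fun x hx => by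
        obtain rfl : x = fun _ => e z * a * e z := funext hx
        exact he.tendsto_prod (fun _ => z) _ (fun _ => hleft) (fun _ => hright) fun _ => hiso
      obtain ⟨u, hu⟩ := hR.isUnit_one_sub (hnil.isTopologicallyNilpotent rfl)
      refine .inr ⟨↑u⁻¹, ?_⟩
      rw [Units.mul_inv_eq_iff_eq_mul, hu, mul_sub, mul_one, hleft]

theorem mem_topJacobson_iff (he : IsPerfectFamily e) (hR : IsCompleteGroup R) {r : R} :
    r ∈ topJacobson R ↔ ∀ z s, e z * r * s ≠ e z := by
  refine ⟨fun hr z => (he.isLocalIdempotent hR z).topJacobson_le hr, fun hr =>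
    mem_topJacobson_of_forall_isUnit fun t => hR.isUnit_one_sub ?_⟩
  refine he.isTopLeftTNilpotent.isTopologicallyNilpotent fun z s => ?_
  simpa only [mul_assoc] using hr z (t * s)

theorem mul_mem_topJacobson_iff (he : IsPerfectFamily e) (hR : IsCompleteGroup R) {z : Z}
    {r : R} : e z * r ∈ topJacobson R ↔ ∀ s, e z * r * s ≠ e z := by
  rw [he.mem_topJacobson_iff hR]
  refine ⟨fun h s => ?_, fun h w s => ?_⟩
  · simpa only [← mul_assoc, (he.idem z).eq] using h z s
  · by_cases hwz : w = z
    · subst hwz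
      simpa only [← mul_assoc, (he.idem w).eq] using h s
    · rw [← mul_assoc, he.ortho hwz, zero_mul, zero_mul]
      exact (he.ne_zero w).symm

theorem isStronglyClosed_topJacobson (he : IsPerfectFamily e) (hR : IsCompleteGroup R) :
    IsStronglyClosed (topJacobson R).toAddSubgroup := by
  refine he.isStronglyClosed hR isClosed_topJacobson fun z => ?_
  simp only [he.mul_mem_topJacobson_iff hR]
  exact (he.isLocalIdempotent hR z).isOpen_maximalRightIdeal

theorem isTopLeftTNilpotent_topJacobson (he : IsPerfectFamily e) (hR : IsCompleteGroup R) :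
    IsTopLeftTNilpotent (topJacobson R : Set R) :=
  fun a ha => he.isTopLeftTNilpotent a fun i => (he.mem_topJacobson_iff hR).1 (ha i)

theorem isSemisimpleFamily_mk (he : IsPerfectFamily e) (hR : IsCompleteGroup R) :
    IsSemisimpleFamily fun z => Ideal.Quotient.mk (topJacobson R) (e z) where
  toTopCompleteOrthogonalIdempotents :=
    he.map (Ideal.Quotient.mk (topJacobson R)) (isOpenQuotientMap_mk _).continuous
  ne_zero z hz := by
    rw [Ideal.Quotient.eq_zero_iff_mem, ← mul_one (e z), he.mul_mem_topJacobson_iff hR] at hz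
    exact hz (e z) (by rw [mul_one, (he.idem z).eq])
  isCornerIso z w a' hza haw ha := by
    obtain ⟨a, rfl⟩ := Ideal.Quotient.mk_surjective a'
    have ha' : Ideal.Quotient.mk (topJacobson R) (e z * (a * e w)) =
        Ideal.Quotient.mk (topJacobson R) a := by
      rw [map_mul, map_mul, haw, hza]
    rw [← ha', ne_eq, Ideal.Quotient.eq_zero_iff_mem, he.mul_mem_topJacobson_iff hR] at ha
    push Not at ha
    obtain ⟨s, hs⟩ := ha
    have hinv : IsCornerInverse (e z) (e w) (e z * (a * e w)) (e w * s) := by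
      refine (he.isLocalIdempotent hR w).isCornerInverse (he.ne_zero z) ?_ ?_ ?_ ?_
      · rw [← mul_assoc, (he.idem z).eq]
      · simp only [mul_assoc, (he.idem w).eq]
      · rw [← mul_assoc, (he.idem w).eq]
      · simpa only [mul_assoc, (he.idem w).mul_self_mul] using hs
    rw [← ha']
    exact ⟨_, hinv.map (Ideal.Quotient.mk (topJacobson R))⟩

end IsPerfectFamily

variable [T2Space R]

theorem IsSemisimpleFamily.isPerfectFamily {H : Ideal R} [H.IsTwoSided] (hR : IsCompleteGroup R)
    (hn : IsTopLeftTNilpotent (H : Set R)) (he : TopCompleteOrthogonalIdempotents e)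
    (hs : IsSemisimpleFamily fun z => Ideal.Quotient.mk H (e z)) : IsPerfectFamily e where
  toTopCompleteOrthogonalIdempotents := he
  ne_zero z hz := hs.ne_zero z (by rw [hz, map_zero])
  tendsto_prod z a hza haz ha := hn a fun i => by
    by_contra hai
    refine ha i (.of_quotient (fun h hh => hR.isUnit_one_sub (hn.isTopologicallyNilpotent hh))
      (he.idem _) (he.idem _) (hza i) (haz i) (hs.isCornerIso _ _ _ ?_ ?_ ?_))
    · rw [← map_mul, hza]
    · rw [← map_mul, haz]
    · rwa [ne_eq, Ideal.Quotient.eq_zero_iff_mem]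

theorem IsStronglyClosed.exists_isPerfectFamily {Z : Type w} {H : Ideal R} [H.IsTwoSided]
    (hH : IsStronglyClosed H.toAddSubgroup) (hR : IsCompleteGroup R)
    (hn : IsTopLeftTNilpotent (H : Set R)) {s : Z → R ⧸ H} (hs : IsSemisimpleFamily s) :
    ∃ e : Z → R, IsPerfectFamily e := by
  obtain ⟨a, ha, has⟩ := hH.exists_lift Z s hs.hasSum_one.summable.tendsto_cofinite_zero
  obtain rfl : (fun z => Ideal.Quotient.mk H (a z)) = s := funext has
  obtain ⟨e, he, hea⟩ := hR.exists_topCompleteOrthogonalIdempotents_lift hH.isClosed hn ha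
    hs.toTopCompleteOrthogonalIdempotents
  simp only [← hea] at hs
  exact ⟨e, hs.isPerfectFamily hR hn he⟩

end PerfectFamilies

/-! ### Topologically semisimple rings have semisimple families -/

section SemisimpleFamilies

theorem IsSemisimpleFamily.map {R S : Type*} [Ring R] [TopologicalSpace R] [Ring S]
    [TopologicalSpace S] {Z : Type*} {e : Z → R} (he : IsSemisimpleFamily e) (φ : R ≃+* S)
    (hφ : Continuous φ) : IsSemisimpleFamily fun z => φ (e z) where
  toTopCompleteOrthogonalIdempotents := he.toTopCompleteOrthogonalIdempotents.map φ.toRingHom hφ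
  ne_zero z := by simpa using he.ne_zero z
  isCornerIso z w a hza haw ha := by
    obtain ⟨a, rfl⟩ := φ.surjective a
    obtain ⟨b, hb⟩ := he.isCornerIso z w a (by simpa [← map_mul] using hza)
      (by simpa [← map_mul] using haw) (by simpa using ha)
    exact ⟨φ b, hb.map φ⟩

theorem isSemisimpleFamily_pi {X : Type*} [DecidableEq X] {R : X → Type*} [∀ x, Ring (R x)]
    [∀ x, TopologicalSpace (R x)] {Y : X → Type*} {e : (x : X) → Y x → R x}
    (he : ∀ x, IsSemisimpleFamily (e x)) :
    IsSemisimpleFamily fun z : Σ x, Y x => (Pi.single z.1 (e z.1 z.2) : (x : X) → R x) where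
  idem z := by rw [IsIdempotentElem, ← Pi.single_mul, ((he z.1).idem z.2).eq]
  ortho := by
    rintro ⟨x, y⟩ ⟨x', y'⟩ hne
    by_cases hx : x = x'
    · subst hx
      have hy : y ≠ y' := fun hy => hne (by rw [hy])
      simp only [← Pi.single_mul, (he x).ortho hy, Pi.single_zero]
    · simp only [← Pi.single_mul_left, Pi.single_eq_of_ne hx, mul_zero, Pi.single_zero]
  hasSum_one := by
    refine Pi.hasSum.2 fun x => ?_
    have hinj : Function.Injective (Sigma.mk x : Y x → Σ x, Y x) := sigma_mk_injective
    refine (hinj.hasSum_iff ?_).1 (by simpa [Function.comp_def] using (he x).hasSum_one)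
    rintro ⟨x', y⟩ hy
    exact Pi.single_eq_of_ne (fun hx => hy (by subst hx; exact ⟨y, rfl⟩)) _
  ne_zero z := by simpa using (he z.1).ne_zero z.2
  isCornerIso := by
    rintro ⟨x, y⟩ ⟨x', y'⟩ a hza haw ha
    have hax : a = Pi.single x (e x y * a x) := by rw [Pi.single_mul_left, hza]
    by_cases hx : x = x'
    · subst hx
      have hxa : e x y * a x = a x := by simpa using congr_fun hza x
      rw [hxa] at hax
      obtain ⟨b, hb⟩ := (he x).isCornerIso y y' (a x) hxa (by simpa using congr_fun haw x)
        fun h0 => ha (by rw [hax, h0, Pi.single_zero])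
      rw [hax]
      exact ⟨_, hb.map (MulHom.single x)⟩
    · rw [← haw, hax] at ha
      simp [← Pi.single_mul_left, Pi.single_eq_of_ne hx] at ha

end SemisimpleFamilies

/-! ### Matrix units -/

section MatrixUnits

variable {D : Type*} [DivisionRing D] {Y : Type*}

/-- The endomorphism `v ↦ single y' (v y * d)` of a vector space with a basis. -/
def matrixUnit (y y' : Y) (d : D) : Module.End D (Y →₀ D) :=
  Finsupp.lsingle y' ∘ₗ LinearMap.toSpanSingleton D D d ∘ₗ Finsupp.lapply y

theorem matrixUnit_apply (y y' : Y) (d : D) (v : Y →₀ D) :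
    matrixUnit y y' d v = Finsupp.single y' (v y * d) := rfl

theorem matrixUnit_mul (y y' y'' : Y) (d d' : D) :
    matrixUnit y' y'' d' * matrixUnit y y' d = matrixUnit y y'' (d * d') :=
  LinearMap.ext fun v => by simp [matrixUnit_apply, mul_assoc]

theorem matrixUnit_mul_of_ne {y y' u u' : Y} (h : y' ≠ u) (d d' : D) :
    matrixUnit u u' d' * matrixUnit y y' d = 0 :=
  LinearMap.ext fun v => by simp [matrixUnit_apply, Finsupp.single_eq_of_ne' h]

theorem matrixUnit_mul_mul (y y' : Y) (f : Module.End D (Y →₀ D)) :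
    matrixUnit y' y' 1 * f * matrixUnit y y 1 = matrixUnit y y' (f (Finsupp.single y 1) y') := by
  refine LinearMap.ext fun v => ?_
  have : Finsupp.single y (v y) = v y • Finsupp.single y (1 : D) := by simp
  simp only [Module.End.mul_apply, matrixUnit_apply, mul_one]
  rw [this, map_smul, Finsupp.smul_apply, smul_eq_mul]

theorem matrixUnit_ne_zero_iff {y y' : Y} {d : D} : matrixUnit y y' d ≠ 0 ↔ d ≠ 0 := by
  refine not_congr ⟨fun h => ?_, fun h => LinearMap.ext fun v => by simp [matrixUnit_apply, h]⟩
  simpa [matrixUnit_apply] using DFunLike.congr_fun h (Finsupp.single y 1)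

end MatrixUnits

section FiniteTopology

attribute [local instance] finiteTopology

theorem hasSum_finiteTopology {A M : Type*} [Ring A] [AddCommGroup M] [Module A M] {Z : Type*}
    {f : Z → Module.End A M} {g : Module.End A M} (F : M → Finset Z)
    (hF : ∀ v, ∀ z ∉ F v, f z v = 0) (hg : ∀ v, ∑ z ∈ F v, f z v = g v) : HasSum f g := by
  let _ : TopologicalSpace M := ⊥
  let φ : Module.End A M →+ M → M :=
    { toFun := fun f => f, map_zero' := rfl, map_add' := fun _ _ => rfl }
  have hφ : Topology.IsInducing φ := Topology.IsInducing.induced _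
  refine (hφ.hasSum_iff f g).1 (Pi.hasSum.2 fun v => ?_)
  have hsum : HasSum (fun z => f z v) (∑ z ∈ F v, f z v) := hasSum_sum_of_ne_finset_zero (hF v)
  rwa [hg v] at hsum

theorem isSemisimpleFamily_matrixUnit (D Y : Type*) [DivisionRing D] : IsSemisimpleFamily
    fun y : Y => (MulOpposite.op (matrixUnit y y 1) : (Module.End D (Y →₀ D))ᵐᵒᵖ) where
  idem y := by rw [IsIdempotentElem, ← MulOpposite.op_mul, matrixUnit_mul, mul_one]
  ortho y y' h := by
    simp only [← MulOpposite.op_mul, matrixUnit_mul_of_ne h, MulOpposite.op_zero]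
  hasSum_one := by
    refine HasSum.op (hasSum_finiteTopology (fun v => v.support) (fun v y hy => ?_) fun v => ?_)
    · simpa [matrixUnit_apply] using hy
    · simp only [matrixUnit_apply, mul_one]
      exact v.sum_single
  ne_zero y := by simpa using matrixUnit_ne_zero_iff.2 one_ne_zero
  isCornerIso y y' a hya hay ha := by
    obtain ⟨f, rfl⟩ := MulOpposite.op_surjective a
    obtain ⟨d, rfl⟩ : ∃ d, f = matrixUnit y y' d := by
      refine ⟨_, Eq.trans ?_ (matrixUnit_mul_mul y y' f)⟩
      rw [← MulOpposite.op_inj, MulOpposite.op_mul, MulOpposite.op_mul, hay, hya]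
    have hd : d ≠ 0 := matrixUnit_ne_zero_iff.1 fun h => ha (by rw [h, MulOpposite.op_zero])
    refine ⟨MulOpposite.op (matrixUnit y' y d⁻¹), hya, ?_, ?_, ?_⟩
    · rw [← MulOpposite.op_mul, matrixUnit_mul, one_mul]
    · rw [← MulOpposite.op_mul, matrixUnit_mul, mul_inv_cancel₀ hd]
    · rw [← MulOpposite.op_mul, matrixUnit_mul, inv_mul_cancel₀ hd]

theorem IsTopSemisimple.exists_isSemisimpleFamily {S : Type w} [Ring S] [TopologicalSpace S]
    (hS : IsTopSemisimple S) : ∃ (Z : Type w) (e : Z → S), IsSemisimpleFamily e := by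
  classical
  obtain ⟨X, Y, D, _, -, φ, hφ⟩ := hS
  exact ⟨_, _, (isSemisimpleFamily_pi fun x => isSemisimpleFamily_matrixUnit (D x) (Y x)).map
    φ.symm (φ.toEquiv.continuous_symm_iff.2 hφ.isOpenMap)⟩

end FiniteTopology

/-! ### Rings with a semisimple family are topologically semisimple -/

section FiniteTopology

attribute [local instance] finiteTopology

theorem isOpen_setOf_apply_eq {A M : Type*} [Ring A] [AddCommGroup M] [Module A M] (v c : M) :
    IsOpen {f : Module.End A M | f v = c} := by
  let _ : TopologicalSpace M := ⊥
  have : DiscreteTopology M := ⟨rfl⟩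
  have hcont : Continuous fun f : Module.End A M => f v :=
    (continuous_apply v).comp continuous_induced_dom
  exact (isOpen_discrete {c}).preimage hcont

theorem continuous_finiteTopology_of_isOpen {T A M : Type*} [TopologicalSpace T] [Ring A]
    [AddCommGroup M] [Module A M] {g : T → Module.End A M}
    (hg : ∀ v c, IsOpen {t | g t v = c}) : Continuous g := by
  let _ : TopologicalSpace M := ⊥
  have : DiscreteTopology M := ⟨rfl⟩
  exact continuous_induced_rng.2 (continuous_pi fun v => continuous_discrete_rng.2 (hg v))

theorem continuous_conjRingEquiv {A M N : Type*} [Ring A] [AddCommGroup M] [Module A M]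
    [AddCommGroup N] [Module A N] (φ : M ≃ₗ[A] N) : Continuous φ.conjRingEquiv := by
  refine continuous_finiteTopology_of_isOpen fun v c => ?_
  convert isOpen_setOf_apply_eq (A := A) (φ.symm v) (φ.symm c) using 1
  ext f
  exact (LinearEquiv.eq_symm_apply φ).symm

theorem isTopSemisimple_of_ringEquiv {S : Type w} [Ring S] [TopologicalSpace S] {X : Type w}
    (D V : X → Type w) [∀ x, DivisionRing (D x)] [∀ x, AddCommGroup (V x)]
    [∀ x, Module (D x) (V x)] [∀ x, Nontrivial (V x)]
    (φ : S ≃+* ((x : X) → (Module.End (D x) (V x))ᵐᵒᵖ)) (hφ : IsHomeomorph φ) :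
    IsTopSemisimple S := by
  let b (x : X) := Module.Basis.ofVectorSpace (D x) (V x)
  let ψ := RingEquiv.piCongrRight fun x => RingEquiv.op (b x).repr.conjRingEquiv
  have continuous_pi_conj {V V' : X → Type w} [∀ x, AddCommGroup (V x)] [∀ x, Module (D x) (V x)]
      [∀ x, AddCommGroup (V' x)] [∀ x, Module (D x) (V' x)] (f : ∀ x, V x ≃ₗ[D x] V' x) :
      Continuous (RingEquiv.piCongrRight fun x => RingEquiv.op (f x).conjRingEquiv) :=
    continuous_pi fun x => MulOpposite.continuous_op.comp ((continuous_conjRingEquiv (f x)).comp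
      (MulOpposite.continuous_unop.comp (continuous_apply x)))
  have hψ : IsHomeomorph ψ := .mk (continuous_pi_conj fun x => (b x).repr)
    (ψ.toEquiv.continuous_symm_iff.1 (continuous_pi_conj fun x => (b x).repr.symm)) ψ.bijective
  exact ⟨X, _, D, inferInstance, fun x => (b x).index_nonempty, φ.trans ψ, hψ.comp hφ⟩

end FiniteTopology

section CornerModule

variable {R : Type*} [Ring R] {e : R}

/-- The right module `e * R` of an idempotent `e`. -/
def cornerModule (e : R) : Submodule Rᵐᵒᵖ R where
  carrier := {s | e * s = s}
  add_mem' {s t} (hs : e * s = s) (ht : e * t = t) := by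
    rw [Set.mem_ofPred_eq, mul_add, hs, ht]
  zero_mem' := mul_zero e
  smul_mem' c s (hs : e * s = s) := by
    rw [Set.mem_ofPred_eq, MulOpposite.smul_eq_mul_unop, ← mul_assoc, hs]

theorem mem_cornerModule {s : R} : s ∈ cornerModule e ↔ e * s = s :=
  Iff.rfl

theorem exists_end_cornerModule {c : R} (hc : e * c = c) :
    ∃ d : Module.End Rᵐᵒᵖ (cornerModule e), ∀ s, (d s : R) = c * s :=
  ⟨(LinearMap.mulLeft Rᵐᵒᵖ c).restrict fun s _ => mul_mem_rightIdeal _ (mem_cornerModule.2 hc) s,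
    fun _ => rfl⟩

/-- The action of a ring on a right module, by endomorphisms over the endomorphism ring of this
module. -/
def rightAction (V : Type*) [AddCommGroup V] [Module Rᵐᵒᵖ V] :
    R →+* (Module.End (Module.End Rᵐᵒᵖ V) V)ᵐᵒᵖ :=
  (RingHom.op (Module.toModuleEnd (Module.End Rᵐᵒᵖ V) V)).comp (RingEquiv.opOp R).toRingHom

end CornerModule

namespace IsSemisimpleFamily

section SimpleModules

variable {R : Type*} [Ring R] [TopologicalSpace R] [IsTopologicalRing R] [T2Space R] {Z : Type*}
  {e : Z → R}

theorem exists_mul_eq_idem (he : IsSemisimpleFamily e) {z : Z} {s : R} (hs : e z * s = s)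
    (h0 : s ≠ 0) : ∃ t, s * t = e z := by
  obtain ⟨w, hw⟩ : ∃ w, s * e w ≠ 0 := by
    by_contra! hzero
    have hsum := he.hasSum_one.mul_left s
    simp only [hzero, mul_one] at hsum
    exact h0 (hsum.unique hasSum_zero)
  obtain ⟨b, hb⟩ := he.isCornerIso z w (s * e w) (by rw [← mul_assoc, hs])
    (by rw [mul_assoc, (he.idem w).eq]) hw
  exact ⟨e w * b, by rw [← mul_assoc, hb.mul_eq_left]⟩

theorem isSimpleModule_cornerModule (he : IsSemisimpleFamily e) (z : Z) :
    IsSimpleModule Rᵐᵒᵖ (cornerModule (e z)) := by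
  refine isSimpleModule_iff_toSpanSingleton_surjective.2
    ⟨⟨⟨e z, he.idem z⟩, 0, fun h => he.ne_zero z (congrArg Subtype.val h)⟩, fun s hs t => ?_⟩
  obtain ⟨r, hr⟩ := he.exists_mul_eq_idem s.2 fun h => hs (Subtype.ext h)
  exact ⟨MulOpposite.op (r * t), Subtype.ext (by
    change (s : R) * (r * t) = t
    rw [← mul_assoc, hr, t.2])⟩

variable [IsLinearTopology Rᵐᵒᵖ R]

theorem exists_open_rightIdeal_inf_cornerModule (he : IsSemisimpleFamily e) (z : Z) :
    ∃ U : Submodule Rᵐᵒᵖ R, IsOpen (U : Set R) ∧ ∀ s ∈ U, e z * s = s → s = 0 := by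
  obtain ⟨U, hU, hzU⟩ := exists_open_rightIdeal_notMem (he.ne_zero z)
  refine ⟨U, hU, fun s hsU hs => by_contra fun h0 => hzU ?_⟩
  obtain ⟨t, ht⟩ := he.exists_mul_eq_idem hs h0
  exact ht ▸ mul_mem_rightIdeal U hsU t

theorem isOpen_setOf_mul_eq (he : IsSemisimpleFamily e) {z : Z} {s : R} (hs : e z * s = s)
    (t : R) : IsOpen {r | s * r = t} := by
  obtain ⟨U, hU, hzU⟩ := he.exists_open_rightIdeal_inf_cornerModule z
  refine isOpen_iff_forall_mem_open.2 fun r₀ hr₀ => ⟨{r | s * (r - r₀) ∈ U}, fun r hr => ?_,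
    hU.preimage (by fun_prop), by simp⟩
  have hzero : s * (r - r₀) = 0 := hzU _ hr (by rw [← mul_assoc, hs])
  rw [mul_sub, sub_eq_zero] at hzero
  exact hzero.trans hr₀

theorem exists_sum_mul_eq (he : IsSemisimpleFamily e) {z : Z} {s : R} (hs : e z * s = s) :
    ∃ F : Finset Z, ∑ w ∈ F, s * e w = s := by
  obtain ⟨U, hU, hzU⟩ := he.exists_open_rightIdeal_inf_cornerModule z
  have hF := (he.zeroConvergent.const_mul s).finite_notMem hU
  refine ⟨hF.toFinset, (hasSum_sum_of_ne_finset_zero fun w hw => ?_).unique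
    (by simpa using he.hasSum_one.mul_left s)⟩
  exact hzU _ (by simpa using hw) (by rw [← mul_assoc, hs])

end SimpleModules

variable {R : Type w} [Ring R] [TopologicalSpace R] {Z : Type w} {e : Z → R}

/-- The equivalence relation on the indices for which the classes are the isomorphism classes of
the right modules `e z * R`. -/
def isoSetoid (he : IsSemisimpleFamily e) : Setoid Z where
  r z w := ∃ a b, IsCornerInverse (e z) (e w) a b
  iseqv :=
    { refl := fun z => ⟨_, _, .refl (he.idem z)⟩
      symm := fun ⟨_, _, h⟩ => ⟨_, _, h.symm⟩
      trans := fun ⟨_, _, h⟩ ⟨_, _, h'⟩ => ⟨_, _, h.trans h'⟩ }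

variable (he : IsSemisimpleFamily e)

/-- The isomorphism class of the right module `e w * R`. -/
abbrev isoClass (w : Z) : Quotient he.isoSetoid := Quotient.mk _ w

/-- A representative of an isomorphism class of right modules `e z * R`. -/
abbrev SimpleModule (x : Quotient he.isoSetoid) : Type w := cornerModule (e x.out)

variable {he} in
theorem exists_generator (w : Z) : ∃ (u : he.SimpleModule (he.isoClass w)) (v : R),
    IsCornerInverse (e (he.isoClass w).out) (e w) u v := by
  obtain ⟨u, v, h⟩ := Quotient.mk_out (s := he.isoSetoid) w
  exact ⟨⟨u, h.left_mul⟩, v, h⟩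

/-- The action of the ring on all the simple modules. -/
def simpleAction : R →+* ((x : Quotient he.isoSetoid) →
    (Module.End (Module.End Rᵐᵒᵖ (he.SimpleModule x)) (he.SimpleModule x))ᵐᵒᵖ) :=
  RingHom.pi fun x => rightAction (he.SimpleModule x)

theorem coe_simpleAction_apply (r : R) {x : Quotient he.isoSetoid} (s : he.SimpleModule x) :
    ((he.simpleAction r x).unop s : R) = s * r := rfl

variable [IsTopologicalRing R] [T2Space R]

instance (x : Quotient he.isoSetoid) : IsSimpleModule Rᵐᵒᵖ (he.SimpleModule x) :=
  he.isSimpleModule_cornerModule _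

instance (x : Quotient he.isoSetoid) : Nontrivial (he.SimpleModule x) :=
  IsSimpleModule.nontrivial Rᵐᵒᵖ _

instance (x : Quotient he.isoSetoid) : DivisionRing (Module.End Rᵐᵒᵖ (he.SimpleModule x)) :=
  letI := Classical.decEq (Module.End Rᵐᵒᵖ (he.SimpleModule x))
  Module.End.instDivisionRing

theorem simpleAction_injective : Function.Injective he.simpleAction := by
  refine (injective_iff_map_eq_zero _).2 fun r hr => he.eq_of_forall_mul_eq fun w => ?_
  obtain ⟨u, v, huv⟩ := he.exists_generator w
  have hur : (u : R) * r = 0 := by rw [← he.coe_simpleAction_apply, hr]; rfl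
  rw [← huv.mul_eq_right, mul_assoc, hur, mul_zero, mul_zero]

variable [IsLinearTopology Rᵐᵒᵖ R]

variable {he} in
theorem pi_end_ext {u : ∀ w, he.SimpleModule (he.isoClass w)} {v : Z → R}
    (huv : ∀ w, IsCornerInverse (e (he.isoClass w).out) (e w) (u w) (v w))
    {f g : (x : Quotient he.isoSetoid) →
      Module.End (Module.End Rᵐᵒᵖ (he.SimpleModule x)) (he.SimpleModule x)}
    (hfg : ∀ w, f (he.isoClass w) (u w) = g (he.isoClass w) (u w)) : f = g := by
  funext x
  refine LinearMap.ext fun s => ?_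
  obtain ⟨F, hF⟩ := he.exists_sum_mul_eq s.2
  let p (w : Z) : he.SimpleModule x := ⟨s * e w, mul_mem_rightIdeal _ s.2 (e w)⟩
  have hp : s = ∑ w ∈ F, p w := Subtype.ext <| by
    rw [AddSubmonoidClass.coe_finsetSum]
    exact hF.symm
  rw [hp, map_sum, map_sum]
  refine Finset.sum_congr rfl fun w _ => ?_
  by_cases hw : he.isoClass w = x
  · subst hw
    have hsv : e (he.isoClass w).out * (s * v w) = s * v w := by rw [← mul_assoc, s.2]
    obtain ⟨d, hd⟩ := exists_end_cornerModule hsv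
    have hpd : p w = d • u w := Subtype.ext <| by
      rw [Module.End.smul_def, hd, mul_assoc, (huv w).mul_eq_right]
    rw [hpd, map_smul, map_smul, hfg]
  · have hp0 : p w = 0 := by
      by_contra h0
      obtain ⟨b, hb⟩ := he.isCornerIso x.out w (s * e w) (by rw [← mul_assoc, s.2])
        (by rw [mul_assoc, (he.idem w).eq]) fun h => h0 (Subtype.ext h)
      exact hw (Quotient.mk_eq_iff_out.2 ⟨_, _, hb.symm⟩)
    rw [hp0, map_zero, map_zero]

theorem simpleAction_surjective (hR : IsCompleteGroup R) : Function.Surjective he.simpleAction := by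
  intro φ
  choose u v huv using he.exists_generator
  obtain ⟨r, hr⟩ := he.exists_mul_eq hR fun w => v w * (φ (he.isoClass w)).unop (u w)
  have hφ : (fun x => (he.simpleAction r x).unop) = fun x => (φ x).unop :=
    pi_end_ext huv fun w => Subtype.ext <| by
      rw [coe_simpleAction_apply, ← (huv w).mul_right, mul_assoc, hr, ← mul_assoc,
        (huv w).mul_right, ← mul_assoc, (huv w).mul_eq_left, ((φ _).unop (u w)).2]
  exact ⟨r, funext fun x => MulOpposite.unop_injective (congr_fun hφ x)⟩

attribute [local instance] finiteTopology

theorem continuous_simpleAction : Continuous he.simpleAction := by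
  refine continuous_pi fun x => MulOpposite.continuous_op.comp
    (continuous_finiteTopology_of_isOpen (g := fun r => (he.simpleAction r x).unop)
      fun s t => ?_)
  simpa only [Subtype.ext_iff, coe_simpleAction_apply] using he.isOpen_setOf_mul_eq s.2 (t : R)

theorem isOpenMap_simpleAction (hR : IsCompleteGroup R) : IsOpenMap he.simpleAction := by
  refine IsOpenMap.of_nhds_le fun r₀ O hO => ?_
  have hO₀ : (r₀ + ·) ⁻¹' (he.simpleAction ⁻¹' O) ∈ 𝓝 (0 : R) :=
    (continuous_const_add r₀).continuousAt.preimage_mem_nhds (by simpa using hO)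
  obtain ⟨U, hU, hUO⟩ := exists_open_rightIdeal hO₀
  obtain ⟨F, hF⟩ := he.exists_finite_forall_mem (H := ⊥) (P := U.toAddSubgroup) hU bot_le
  choose u v huv using he.exists_generator
  have hN (w : Z) :
      {ψ | (ψ (he.isoClass w)).unop (u w) = (he.simpleAction r₀ (he.isoClass w)).unop (u w)} ∈
        𝓝 (he.simpleAction r₀) :=
    ((isOpen_setOf_apply_eq _ _).preimage
      (MulOpposite.continuous_unop.comp (continuous_apply _))).mem_nhds rfl
  refine mem_of_superset ((biInter_finset_mem F).2 fun w _ => hN w) fun ψ hψ => ?_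
  obtain ⟨r, rfl⟩ := he.simpleAction_surjective hR ψ
  have hrU : r - r₀ ∈ U := hF _ fun w hw => by
    have hur : (u w : R) * r = u w * r₀ := congrArg Subtype.val (Set.mem_iInter₂.1 hψ w hw)
    rw [AddSubgroup.mem_bot, ← (huv w).mul_eq_right, mul_assoc, mul_sub, hur, sub_self, mul_zero]
  simpa using hUO hrU

theorem isTopSemisimple (he : IsSemisimpleFamily e) (hR : IsCompleteGroup R) : IsTopSemisimple R :=
  isTopSemisimple_of_ringEquiv _ he.SimpleModule
    (.ofBijective he.simpleAction ⟨he.simpleAction_injective, he.simpleAction_surjective hR⟩)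
    ⟨he.continuous_simpleAction, he.isOpenMap_simpleAction hR,
      he.simpleAction_injective, he.simpleAction_surjective hR⟩

end IsSemisimpleFamily

section Perfect

variable {R : Type w} [Ring R] [TopologicalSpace R] [IsTopologicalRing R] [IsLinearTopology Rᵐᵒᵖ R]
  [T2Space R]

theorem IsPerfectFamily.isTopLeftPerfect {Z : Type w} {e : Z → R} (he : IsPerfectFamily e)
    (hR : IsCompleteGroup R) : IsTopLeftPerfect R where
  tNilpotent := he.isTopLeftTNilpotent_topJacobson hR
  stronglyClosed := he.isStronglyClosed_topJacobson hR
  semisimple := by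
    have hH := he.isStronglyClosed_topJacobson hR
    have hclosed : IsClosed ((topJacobson R).toAddSubgroup : Set R) := hH.isClosed
    have : T2Space (R ⧸ topJacobson R) :=
      inferInstanceAs (T2Space (R ⧸ (topJacobson R).toAddSubgroup))
    exact (he.isSemisimpleFamily_mk hR).isTopSemisimple hH.complete_quotient

theorem isTopLeftPerfect_iff_exists_isPerfectFamily (hR : IsCompleteGroup R) :
    IsTopLeftPerfect R ↔ ∃ (Z : Type w) (e : Z → R), IsPerfectFamily e := by
  refine ⟨fun h => ?_, fun ⟨_, _, he⟩ => he.isTopLeftPerfect hR⟩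
  obtain ⟨Z, s, hs⟩ := h.semisimple.exists_isSemisimpleFamily
  exact ⟨Z, h.stronglyClosed.exists_isPerfectFamily hR h.tNilpotent hs⟩

end Perfect

/-! ### Topologically agreeable categories -/

section Composition

variable {C : Type u} [Category.{v} C] [Preadditive C] [RightTopological C]

theorem continuous_precomp {L M : C} (f : L ⟶ M) (N : C) :
    Continuous fun g : M ⟶ N => f ≫ g :=
  (RightTopological.continuous_comp L M N).comp (Continuous.prodMk_right f)

theorem continuous_postcomp (L : C) {M N : C} (g : M ⟶ N) :
    Continuous fun f : L ⟶ M => f ≫ g :=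
  (RightTopological.continuous_comp L M N).comp (Continuous.prodMk_left g)

theorem hasSum_precomp {L M N : C} {X : Type*} {f : X → (M ⟶ N)} {s : M ⟶ N} (hf : HasSum f s)
    (g : L ⟶ M) : HasSum (fun x => g ≫ f x) (g ≫ s) :=
  hf.map (Preadditive.leftComp N g) (continuous_precomp g N)

theorem hasSum_postcomp {L M N : C} {X : Type*} {f : X → (L ⟶ M)} {s : L ⟶ M} (hf : HasSum f s)
    (g : M ⟶ N) : HasSum (fun x => f x ≫ g) (s ≫ g) :=
  hf.map (Preadditive.rightComp L g) (continuous_postcomp L g)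

instance (M N : C) : NonarchimedeanAddGroup (M ⟶ N) where
  is_nonarchimedean W hW :=
    let ⟨V, hV, _, hVW⟩ := RightTopological.exists_open_submodule M N W hW
    ⟨⟨V, hV⟩, hVW⟩

instance (M : C) : IsLinearTopology (End M)ᵐᵒᵖᵐᵒᵖ (End M)ᵐᵒᵖ := by
  refine isLinearTopology_of_forall_exists_addSubgroup fun W hW => ?_
  obtain ⟨V, hVo, hV, hVW⟩ := RightTopological.exists_open_submodule M M (MulOpposite.op ⁻¹' W)
    ((MulOpposite.continuous_op (M := End M)).continuousAt.preimage_mem_nhds hW)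
  exact ⟨V.comap (MulOpposite.opAddEquiv (α := End M)).symm.toAddMonoidHom,
    hVo.preimage (MulOpposite.continuous_unop (M := End M)), fun a ha b => hV _ ha b.unop,
    fun a ha => hVW ha⟩

end Composition

theorem IsCompleteGroup.op {A : Type w} [AddCommGroup A] [TopologicalSpace A]
    (hA : IsCompleteGroup A) : IsCompleteGroup Aᵐᵒᵖ := by
  intro a ha
  let F (U : OpenAddSubgroup A) : OpenAddSubgroup Aᵐᵒᵖ :=
    U.comap (MulOpposite.opAddEquiv : A ≃+ Aᵐᵒᵖ).symm.toAddMonoidHom MulOpposite.continuous_unop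
  obtain ⟨x, hx⟩ := hA (fun U => (a (F U)).unop) fun U V hUV => ha (F U) (F V) fun _ h => hUV h
  exact ⟨MulOpposite.op x, fun U => hx
    (U.comap (MulOpposite.opAddEquiv : A ≃+ Aᵐᵒᵖ).toAddMonoidHom MulOpposite.continuous_op)⟩

section Coproducts

variable {C : Type u} [Category.{v} C] [Preadditive C] [HasCoproducts.{v} C]

theorem ι_coprodProj_self {X : Type v} (N : X → C) (x : X) :
    Sigma.ι N x ≫ coprodProj N x = 𝟙 (N x) := by
  classical
  exact Sigma.ι_π_eq_id N x

theorem ι_coprodProj_of_ne {X : Type v} (N : X → C) {x y : X} (h : x ≠ y) :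
    Sigma.ι N x ≫ coprodProj N y = 0 := by
  classical
  exact Sigma.ι_π_of_ne N h

theorem sigmaMap_coprodProj {X : Type v} {N P : X → C} (g : (x : X) → (N x ⟶ P x)) (x : X) :
    Limits.Sigma.map g ≫ coprodProj P x = coprodProj N x ≫ g x := by
  refine Sigma.hom_ext _ _ fun y => ?_
  rw [Sigma.ι_map_assoc]
  by_cases h : y = x
  · subst h
    rw [ι_coprodProj_self, ← Category.assoc, ι_coprodProj_self, Category.comp_id, Category.id_comp]
  · rw [ι_coprodProj_of_ne _ h, ← Category.assoc, ι_coprodProj_of_ne N h, comp_zero, zero_comp]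

theorem IsSummable.comp {M : C} {X : Type v} {N P : X → C} {f : (x : X) → (M ⟶ N x)}
    (hf : IsSummable f) (g : (x : X) → (N x ⟶ P x)) : IsSummable fun x => f x ≫ g x := by
  obtain ⟨F, hF⟩ := hf
  exact ⟨F ≫ Limits.Sigma.map g, fun x => by
    rw [Category.assoc, sigmaMap_coprodProj, ← Category.assoc, hF]⟩

theorem IsSummable.precomp {L M : C} {X : Type v} {N : X → C} {f : (x : X) → (M ⟶ N x)}
    (hf : IsSummable f) (g : L ⟶ M) : IsSummable fun x => g ≫ f x := by
  obtain ⟨F, hF⟩ := hf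
  exact ⟨g ≫ F, fun x => by rw [Category.assoc, hF]⟩

theorem isSummable_coprodProj {X : Type v} (N : X → C) : IsSummable (coprodProj N) :=
  ⟨𝟙 _, fun _ => Category.id_comp _⟩

theorem zeroConvergent_comp_ι [RightTopological C] {M N : C} {X : Type v} {f : X → (M ⟶ N)}
    (hf : ZeroConvergent f) : ZeroConvergent fun x => f x ≫ Sigma.ι (fun _ : X => N) x := by
  cases isEmpty_or_nonempty X with
  | inl _ => simp only [ZeroConvergent, cofinite_eq_bot, tendsto_bot]
  | inr hX =>
    obtain ⟨x₀⟩ := hX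
    intro W hW
    obtain ⟨V, hVo, hV, hVW⟩ := RightTopological.exists_open_submodule _ _ W hW
    have hfV := hf <| (hVo.preimage
      (continuous_postcomp M (Sigma.ι (fun _ : X => N) x₀))).mem_nhds (by simp)
    refine mem_map.2 (mem_of_superset (mem_map.1 hfV) fun x hx => hVW ?_)
    -- The endomorphism of the coproduct which maps all summands onto the summand of `x` maps the
    -- `x₀`-th embedding of `f x` to the `x`-th one.
    have hfx := hV _ hx (Sigma.desc fun _ => Sigma.ι (fun _ : X => N) x)
    rwa [Category.assoc, Sigma.ι_desc] at hfx

variable [RightTopological C] [TopologicallyAgreeable C]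

instance (M N : C) : T2Space (M ⟶ N) := TopologicallyAgreeable.separated M N

instance (M : C) : T2Space (End M) := TopologicallyAgreeable.separated M M

theorem isCompleteGroup_endOp (M : C) : IsCompleteGroup (End M)ᵐᵒᵖ :=
  IsCompleteGroup.op (A := End M) (TopologicallyAgreeable.complete M M)

theorem hasSum_coprodProj_ι {X : Type v} (N : X → C) :
    HasSum (fun x => coprodProj N x ≫ Sigma.ι N x) (𝟙 (∐ N)) := by
  obtain ⟨s, hs⟩ := (TopologicallyAgreeable.complete _ _).summable
    (TopologicallyAgreeable.zeroConvergent_of_summable _ _ _ _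
      ((isSummable_coprodProj N).comp fun x => Sigma.ι N x))
  suffices s = 𝟙 (∐ N) from this ▸ hs
  refine Sigma.hom_ext _ _ fun x => (hasSum_precomp hs (Sigma.ι N x)).unique ?_
  convert hasSum_single x fun y hy => ?_ using 1
  · rw [← Category.assoc, ι_coprodProj_self, Category.id_comp, Category.comp_id]
  · rw [← Category.assoc, ι_coprodProj_of_ne N hy.symm, zero_comp]

theorem isSummable_of_zeroConvergent {M N : C} {X : Type v} {f : X → (M ⟶ N)}
    (hf : ZeroConvergent f) : IsSummable f := by
  obtain ⟨F, hF⟩ := (TopologicallyAgreeable.complete _ _).summable (zeroConvergent_comp_ι hf)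
  refine ⟨F, fun x => (hasSum_postcomp hF (coprodProj _ x)).unique ?_⟩
  convert hasSum_single x fun y hy => ?_ using 1
  · rw [Category.assoc, ι_coprodProj_self, Category.comp_id]
  · rw [Category.assoc, ι_coprodProj_of_ne (fun _ : X => N) hy, comp_zero]

end Coproducts

/-! ### Decompositions of objects and families of idempotents -/

section Decompositions

variable {C : Type u} [Category.{v} C] [Preadditive C] [RightTopological C]

/-- A family of direct summands of `M` with pairwise orthogonal projectors which sum up to the
identity. -/
structure SummandFamily (M : C) {Z : Type v} (N : Z → C) where
  i : (z : Z) → (N z ⟶ M)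
  r : (z : Z) → (M ⟶ N z)
  i_r_self : ∀ z, i z ≫ r z = 𝟙 (N z)
  i_r_of_ne : ∀ {z w}, z ≠ w → i z ≫ r w = 0
  hasSum_id : HasSum (fun z => r z ≫ i z) (𝟙 M)

namespace SummandFamily

section Extend

variable {M : C} {Z : Type v} {N : Z → C} (S : SummandFamily M N)

theorem i_r_self_assoc (z : Z) {L : C} (f : N z ⟶ L) : S.i z ≫ S.r z ≫ f = f := by
  rw [← Category.assoc, S.i_r_self, Category.id_comp]

theorem i_r_of_ne_assoc {z w : Z} (h : z ≠ w) {L : C} (f : N w ⟶ L) : S.i z ≫ S.r w ≫ f = 0 := by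
  rw [← Category.assoc, S.i_r_of_ne h, zero_comp]

/-- The endomorphism of `M` induced by a morphism between two summands, as an element of the
opposite endomorphism ring, in which products are in the order of the diagram. -/
def extend {z w : Z} (f : N z ⟶ N w) : (End M)ᵐᵒᵖ := MulOpposite.op (S.r z ≫ f ≫ S.i w)

theorem unop_extend {z w : Z} (f : N z ⟶ N w) : (S.extend f).unop = S.r z ≫ f ≫ S.i w := rfl

theorem extend_mul {z w u : Z} (f : N z ⟶ N w) (g : N w ⟶ N u) :
    S.extend f * S.extend g = S.extend (f ≫ g) := by
  refine MulOpposite.unop_injective ?_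
  change (S.r z ≫ f ≫ S.i w) ≫ S.r w ≫ g ≫ S.i u = S.r z ≫ (f ≫ g) ≫ S.i u
  simp only [Category.assoc, S.i_r_self_assoc]

theorem extend_mul_of_ne {z w w' u : Z} (h : w ≠ w') (f : N z ⟶ N w) (g : N w' ⟶ N u) :
    S.extend f * S.extend g = 0 := by
  refine MulOpposite.unop_injective ?_
  change (S.r z ≫ f ≫ S.i w) ≫ S.r w' ≫ g ≫ S.i u = 0
  simp only [Category.assoc, S.i_r_of_ne_assoc h, comp_zero]

theorem extend_injective {z w : Z} : Function.Injective (S.extend (z := z) (w := w)) := by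
  refine Function.LeftInverse.injective (g := fun a => S.i z ≫ a.unop ≫ S.r w) fun f => ?_
  simp only [unop_extend, Category.assoc, S.i_r_self_assoc, S.i_r_self, Category.comp_id]

theorem extend_zero (z w : Z) : S.extend (0 : N z ⟶ N w) = 0 := by
  simp only [extend, zero_comp, comp_zero, MulOpposite.op_zero]

/-- The projector onto a summand. -/
def idem (z : Z) : (End M)ᵐᵒᵖ := S.extend (𝟙 (N z))

theorem idem_mul_extend {z w : Z} (f : N z ⟶ N w) : S.idem z * S.extend f = S.extend f := by
  rw [idem, extend_mul, Category.id_comp]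

theorem extend_mul_idem {z w : Z} (f : N z ⟶ N w) : S.extend f * S.idem w = S.extend f := by
  rw [idem, extend_mul, Category.comp_id]

theorem exists_extend_eq {z w : Z} {a : (End M)ᵐᵒᵖ} (hza : S.idem z * a = a)
    (haw : a * S.idem w = a) : ∃ f : N z ⟶ N w, S.extend f = a := by
  refine ⟨S.i z ≫ a.unop ≫ S.r w, MulOpposite.unop_injective ?_⟩
  conv_rhs => rw [← haw, ← hza]
  change _ = ((S.r z ≫ 𝟙 _ ≫ S.i z) ≫ a.unop) ≫ S.r w ≫ 𝟙 _ ≫ S.i w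
  simp only [unop_extend, Category.assoc, Category.id_comp]

theorem topCompleteOrthogonalIdempotents : TopCompleteOrthogonalIdempotents S.idem where
  idem z := S.idem_mul_extend _
  ortho _ _ h := S.extend_mul_of_ne h _ _
  hasSum_one := by
    have h : S.idem = fun z => MulOpposite.op (S.r z ≫ S.i z) :=
      funext fun z => by rw [idem, extend, Category.id_comp]
    rw [h]
    exact HasSum.op (α := End M) S.hasSum_id

theorem isCornerIso_extend_iff {z w : Z} (f : N z ⟶ N w) :
    IsCornerIso (S.idem z) (S.idem w) (S.extend f) ↔ IsIso f := by
  constructor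
  · rintro ⟨b, hb⟩
    obtain ⟨g, rfl⟩ := S.exists_extend_eq hb.right_mul hb.symm.mul_right
    have hfg := hb.mul_eq_left
    have hgf := hb.mul_eq_right
    rw [extend_mul] at hfg hgf
    exact ⟨g, S.extend_injective hfg, S.extend_injective hgf⟩
  · intro hf
    refine ⟨S.extend (inv f), S.idem_mul_extend _, S.idem_mul_extend _, ?_, ?_⟩
    · rw [extend_mul, IsIso.hom_inv_id, idem]
    · rw [extend_mul, IsIso.inv_hom_id, idem]

theorem idem_eq_zero_iff (z : Z) : S.idem z = 0 ↔ IsZero (N z) := by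
  rw [IsZero.iff_id_eq_zero, ← S.extend_injective.eq_iff, S.extend_zero, idem]

theorem prod_extend (z : ℕ → Z) (f : (i : ℕ) → (N (z i) ⟶ N (z (i + 1)))) (n : ℕ) :
    ((List.range (n + 1)).map fun i => S.extend (f i)).prod =
      S.extend (compSeq (N := fun i => N (z i)) f n) := by
  induction n with
  | zero => simp [compSeq]
  | succ n ih =>
    rw [List.range_succ, List.map_append, List.prod_append, ih, List.map_singleton,
      List.prod_singleton, extend_mul]
    rfl

end Extend

section TopologicallyAgreeable

variable [HasCoproducts.{v} C] [TopologicallyAgreeable C] {M : C} {Z : Type v} {N : Z → C}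

theorem isSummable_iff_zeroConvergent_extend (S : SummandFamily M N) {X : Type v} {z : Z}
    {w : X → Z} {f : (x : X) → (N z ⟶ N (w x))} :
    IsSummable f ↔ ZeroConvergent fun x => S.extend (f x) := by
  refine ⟨fun hf => ?_, fun hf => ?_⟩
  · exact ((MulOpposite.continuous_op (M := End M)).tendsto' 0 0 rfl).comp
      (TopologicallyAgreeable.zeroConvergent_of_summable _ _ _ _
        ((hf.comp fun x => S.i (w x)).precomp (S.r z)))
  · have hfi : ZeroConvergent fun x => f x ≫ S.i (w x) := by
      have h := ((continuous_precomp (S.i z) M).tendsto' 0 0 comp_zero).comp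
        (((MulOpposite.continuous_unop (M := End M)).tendsto' 0 0 rfl).comp hf)
      simp only [Function.comp_def, unop_extend, S.i_r_self_assoc] at h
      exact h
    simpa only [Category.assoc, S.i_r_self, Category.comp_id] using
      (isSummable_of_zeroConvergent hfi).comp fun x => S.r (w x)

theorem isSummable_iff_tendsto_extend (S : SummandFamily M N) {z : Z} {w : ℕ → Z}
    {f : (n : ℕ) → (N z ⟶ N (w n))} :
    IsSummable (fun n : ULift.{v} ℕ => f n.down) ↔
      Tendsto (fun n => S.extend (f n)) atTop (𝓝 0) := by
  rw [S.isSummable_iff_zeroConvergent_extend, ← Nat.cofinite_eq_atTop]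
  exact ⟨fun h => h.comp ULift.up_injective.tendsto_cofinite,
    fun h => h.comp ULift.down_injective.tendsto_cofinite⟩

theorem isPerfectFamily_iff (S : SummandFamily M N) :
    IsPerfectFamily S.idem ↔ IsLocallyTNilpotent N := by
  refine ⟨fun h => ⟨fun z hz => h.ne_zero z ((S.idem_eq_zero_iff z).2 hz), fun z f hf => ?_⟩,
    fun h => ⟨S.topCompleteOrthogonalIdempotents,
      fun z hz => h.nonzero z ((S.idem_eq_zero_iff z).1 hz), fun z a hza haz ha => ?_⟩⟩
  · rw [S.isSummable_iff_tendsto_extend]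
    simp only [← S.prod_extend]
    exact h.tendsto_prod z _ (fun i => S.idem_mul_extend _) (fun i => S.extend_mul_idem _)
      fun i hi => hf i ((S.isCornerIso_extend_iff _).1 hi)
  · choose f hf using fun i => S.exists_extend_eq (hza i) (haz i)
    obtain rfl : (fun i => S.extend (f i)) = a := funext hf
    simp only [S.prod_extend]
    exact S.isSummable_iff_tendsto_extend.1
      (h.summable z f fun i hi => ha i ((S.isCornerIso_extend_iff _).2 hi))

theorem nonempty_iso (S : SummandFamily M N) : Nonempty (M ≅ ∐ N) := by
  obtain ⟨F, hF⟩ := (isSummable_of_zeroConvergent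
    S.hasSum_id.summable.tendsto_cofinite_zero).comp S.r
  simp only [Category.assoc, S.i_r_self, Category.comp_id] at hF
  refine ⟨F, Sigma.desc S.i, ?_, Sigma.hom_ext _ _ fun z => ?_⟩
  · have hsum := hasSum_precomp (hasSum_postcomp (hasSum_coprodProj_ι N) (Sigma.desc S.i)) F
    simp only [Category.id_comp, Category.assoc, Sigma.ι_desc] at hsum
    simp only [← Category.assoc, hF] at hsum
    exact hsum.unique S.hasSum_id
  · refine Agreeable.eta_injective _ _ _ (funext fun w => ?_)
    simp only [Sigma.ι_desc_assoc, Category.assoc, Category.comp_id, hF]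
    by_cases h : z = w
    · subst h
      rw [S.i_r_self, ι_coprodProj_self]
    · rw [S.i_r_of_ne h, ι_coprodProj_of_ne N h]

/-- The summands of an object isomorphic to a coproduct. -/
def ofIso (φ : M ≅ ∐ N) : SummandFamily M N where
  i z := Sigma.ι N z ≫ φ.inv
  r z := φ.hom ≫ coprodProj N z
  i_r_self z := by simp [ι_coprodProj_self]
  i_r_of_ne h := by simp [ι_coprodProj_of_ne N h]
  hasSum_id := by
    simpa using hasSum_postcomp (hasSum_precomp (hasSum_coprodProj_ι N) φ.hom) φ.inv

end TopologicallyAgreeable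

end SummandFamily

theorem TopCompleteOrthogonalIdempotents.exists_summandFamily [IsIdempotentComplete C] {M : C}
    {Z : Type v} {e : Z → (End M)ᵐᵒᵖ} (he : TopCompleteOrthogonalIdempotents e) :
    ∃ (N : Z → C) (S : SummandFamily M N), S.idem = e := by
  choose N i r hir hri using fun z => IsIdempotentComplete.idempotents_split M (e z).unop
    (congrArg MulOpposite.unop (he.idem z).eq)
  refine ⟨N, ⟨i, r, hir, fun {z w} h => ?_, ?_⟩, funext fun z => MulOpposite.unop_injective ?_⟩
  · have hzw : (e z).unop ≫ (e w).unop = 0 := congrArg MulOpposite.unop (he.ortho h)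
    calc i z ≫ r w = (i z ≫ r z) ≫ (i z ≫ r w) ≫ i w ≫ r w := by
          rw [hir, hir, Category.id_comp, Category.comp_id]
      _ = i z ≫ ((e z).unop ≫ (e w).unop) ≫ r w := by simp only [← hri, Category.assoc]
      _ = 0 := by rw [hzw, zero_comp, comp_zero]
  · simp only [hri]
    exact HasSum.unop he.hasSum_one
  · rw [SummandFamily.idem, SummandFamily.unop_extend, Category.id_comp, hri]

theorem hasPerfectDecomposition_iff_exists_isPerfectFamily [HasCoproducts.{v} C]
    [TopologicallyAgreeable C] [IsIdempotentComplete C] (M : C) :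
    HasPerfectDecomposition M ↔ ∃ (Z : Type v) (e : Z → (End M)ᵐᵒᵖ), IsPerfectFamily e := by
  constructor
  · rintro ⟨Z, N, hN, ⟨φ⟩⟩
    exact ⟨Z, _, (SummandFamily.ofIso φ).isPerfectFamily_iff.2 hN⟩
  · rintro ⟨Z, e, he⟩
    obtain ⟨N, S, rfl⟩ := he.exists_summandFamily
    exact ⟨Z, N, S.isPerfectFamily_iff.1 he, S.nonempty_iso⟩

end Decompositions

end TopPerfect

end

theorem mainTheorem5 {C : Type u} [Category.{v} C] [Preadditive C] [HasFiniteBiproducts C]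
    [HasCoproducts.{v} C] [IsIdempotentComplete C] [TopPerfect.RightTopological C]
    [TopPerfect.TopologicallyAgreeable C] (M : C) :
    TopPerfect.HasPerfectDecomposition M ↔ TopPerfect.IsTopLeftPerfect (End M)ᵐᵒᵖ := by
  rw [TopPerfect.hasPerfectDecomposition_iff_exists_isPerfectFamily,
    TopPerfect.isTopLeftPerfect_iff_exists_isPerfectFamily (TopPerfect.isCompleteGroup_endOp M)]
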